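/- Let $\Omega\subset\mathbb{R}^2$ be a bounded polygonal domain whose boundary $\partial\Omega$ is connected (equivalently, $\Omega$ is simply connected), and let $\Gamma\subset\Omega$ be a smooth simple closed curve such that $\Omega\setminus\Gamma$ is the disjoint union of two subdomains $\Omega^-$ and $\Omega^+$. Let $\mu^\pm,\beta^\pm>0$ be constants. Let $\mathcal T_h$ be a finite conforming triangulation of $\overline\Omega$. An element $T$ is an interface element if $\Gamma$ meets the interior of $T$; assume that for each interface element $\Gamma\cap\partial T$ consists of two distinct points $D,E$, lying on two different edges of $T$. Then let $\Gamma_h^T$ be the segment $DE$, with midpoint $X_m$, tangent vector $\bar{\mathbf t}$ and normal vector $\bar{\mathbf n}$, and let $T_h^\pm$ be the two parts into which $\Gamma_h^T$ cuts $T$, where $T_h^\pm$ is the convex hull of $D$, $E$ and the vertices of $T$ lying in the closure of $T\cap\Omega^\pm$. For $\mathbf v=[v_1,v_2]^t$ write $\operatorname{curl}\mathbf v=\partial_{x_1}v_2-\partial_{x_2}v_1$, and let $\mathcal{ND}=\{\mathbf a+b[x_2,-x_1]^t:\mathbf a\in\mathbb R^2,\ b\in\mathbb R\}$. Local spaces.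 On a non-interface element, $\mathcal{IND}_h(T)=\mathcal{ND}$ and $\widetilde S_h(T)=\mathbb P_1(T)$. On an interface element, $\mathcal{IND}_h(T)$ consists of the functions equal to some $\mathbf z^-\in\mathcal{ND}$ on $T_h^-$ and to some $\mathbf z^+\in\mathcal{ND}$ on $T_h^+$ with $$\mathbf z^+\cdot\bar{\mathbf t}=\mathbf z^-\cdot\bar{\mathbf t},\qquad \tfrac1{\mu^+}\operatorname{curl}\mathbf z^+=\tfrac1{\mu^-}\operatorname{curl}\mathbf z^-,\qquad \beta^+\mathbf z^+\cdot\bar{\mathbf n}=\beta^-\mathbf z^-\cdot\bar{\mathbf n}\qquad\text{at }X_m,$$ and $\widetilde S_h(T)$ consists of the functions equal to polynomials $z^\pm$ of degree at most $1$ on $T_h^\pm$ with $z^+=z^-$ and $\beta^+\nabla z^+\cdot\bar{\mathbf n}=\beta^-\nabla z^-\cdot\bar{\mathbf n}$ on $\Gamma_h^T$. Global spaces. $\mathcal{IND}_{h,0}(\Omega)$ is the space of all $\mathbf v\in \mathbf L^2(\Omega)$ with $\mathbf v|_T\in\mathcal{IND}_h(T)$ for every $T\in\mathcal T_h$, with $\int_e\mathbf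 v|_{T_1}\cdot\mathbf t\,ds=\int_e\mathbf v|_{T_2}\cdot\mathbf t\,ds$ whenever $T_1,T_2$ share the edge $e$, and with $\mathbf v\cdot\mathbf t=0$ on each boundary edge. $\widetilde S_{h,0}(\Omega)$ is the space of all $v\in L^2(\Omega)$ with $v|_T\in\widetilde S_h(T)$ for every $T\in\mathcal T_h$, continuous at the mesh nodes, with $v=0$ on $\partial\Omega$. $Q_h\subset L^2(\Omega)$ is the space of functions that are constant on each non-interface element and on each of $T_h^-$, $T_h^+$ for every interface element $T$. Then, with $\nabla$ and $\operatorname{curl}$ taken element by element, in the weak sense in the interior of each $T\in\mathcal T_h$, the sequence $$\widetilde S_{h,0}(\Omega)\xrightarrow{\ \nabla\ }\mathcal{IND}_{h,0}(\Omega)\xrightarrow{\ \operatorname{curl}\ }Q_h$$ is well defined and exact at $\mathcal{IND}_{h,0}(\Omega)$; that is, $\nabla$ maps $\widetilde S_{h,0}(\Omega)$ into $\mathcal{IND}_{h,0}(\Omega)$, $\operatorname{curl}$ maps $\mathcal{IND}_{h,0}(\Omega)$ into $Q_h$, and $$\nabla\widetilde S_{h,0}(\Omega)=\{\mathbf z_h\in\mathcal{IND}_{h,0}(\Omega):\operatorname{curl}\mathbf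 z_h=0\}.$$ -/

import Mathlib

open MeasureTheory Set
open scoped ContDiff

noncomputable section

/-- The Euclidean plane. -/
abbrev Plane := EuclideanSpace ℝ (Fin 2)

/-- `Γ` is a smooth simple closed (Jordan) curve: it has a smooth regular `1`-periodic
parametrization that is injective on a period. -/
def IsSmoothJordanCurve (Γ : Set Plane) : Prop :=
  ∃ γ : ℝ → Plane, ContDiff ℝ ∞ γ ∧ Function.Periodic γ 1 ∧ InjOn γ (Ico 0 1) ∧
    (∀ t, deriv γ t ≠ 0) ∧ range γ = Γ

/-- The data of the interface problem and of its mesh: the domain, its two subdomains, the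
interface, the triangular mesh (given by its vertices, edges and triangles), and the values of the
piecewise constant coefficients `μ` and `β` on the two subdomains. -/
structure IFEData where
  Ω : Set Plane
  Ωm : Set Plane
  Ωp : Set Plane
  Γ : Set Plane
  mesh : Geometry.SimplicialComplex ℝ Plane
  μm : ℝ
  μp : ℝ
  βm : ℝ
  βp : ℝ

namespace IFEData

variable (P : IFEData)

/-- The elements of the mesh, each one given by its set of three vertices. -/
def elements : Set (Finset Plane) := {T | T ∈ P.mesh.faces ∧ T.card = 3}

/-- The closed triangle with the given vertices. -/
def triangle (T : Finset Plane) : Set Plane := convexHull ℝ (T : Set Plane)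

/-- Interface elements: the interface passes through the interior of the triangle. -/
def IsInterface (T : Finset Plane) : Prop := (P.Γ ∩ interior (triangle T)).Nonempty

/-- The interface meets the boundary of `T` in exactly two distinct points `D` and `E`, which lie
on two different edges `[a, b]` and `[c, d]` of `T`. -/
def IsCut (T : Finset Plane) (D E : Plane) : Prop :=
  D ≠ E ∧ P.Γ ∩ frontier (triangle T) = {D, E} ∧
    ∃ a ∈ T, ∃ b ∈ T, ∃ c ∈ T, ∃ d ∈ T, a ≠ b ∧ c ≠ d ∧ ({a, b} : Set Plane) ≠ {c, d} ∧
      D ∈ segment ℝ a b ∧ E ∈ segment ℝ c d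

/-- The standing assumptions: `Ω` is a bounded polygonal domain with connected boundary, `mesh` is a
finite conforming triangulation of it, the interface is a smooth Jordan curve inside `Ω` that
separates `Ω` into the two subdomains, the coefficients are positive, and the interface meets the
boundary of each interface element in two distinct points on two different edges. -/
structure IsAdmissible : Prop where
  isOpen_Ω : IsOpen P.Ω
  isConnected_Ω : IsConnected P.Ω
  isBounded_Ω : Bornology.IsBounded P.Ω
  isConnected_boundary : IsConnected (frontier P.Ω)
  mesh_finite : P.mesh.faces.Finite
  mesh_pure : ∀ s ∈ P.mesh.faces, ∃ T ∈ P.elements, s ⊆ T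
  mesh_space : P.mesh.space = closure P.Ω
  mesh_interior : interior P.mesh.space = P.Ω
  jordan_Γ : IsSmoothJordanCurve P.Γ
  Γ_subset : P.Γ ⊆ P.Ω
  isOpen_Ωm : IsOpen P.Ωm
  isOpen_Ωp : IsOpen P.Ωp
  isConnected_Ωm : IsConnected P.Ωm
  isConnected_Ωp : IsConnected P.Ωp
  disjoint_Ω : Disjoint P.Ωm P.Ωp
  union_Ω : P.Ωm ∪ P.Ωp = P.Ω \ P.Γ
  μm_pos : 0 < P.μm
  μp_pos : 0 < P.μp
  βm_pos : 0 < P.βm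
  βp_pos : 0 < P.βp
  cut : ∀ T ∈ P.elements, P.IsInterface T → ∃ D E, P.IsCut T D E

/-- The part of the interface element `T`, cut by the chord from `D` to `E`, that belongs to the
subdomain `U`: the polygon spanned by `D`, `E` and the vertices of `T` on the side of `U`. -/
def subElement (T : Finset Plane) (D E : Plane) (U : Set Plane) : Set Plane :=
  convexHull ℝ ({D, E} ∪ {A | A ∈ T ∧ A ∈ closure (triangle T ∩ U)})

/-- The lowest order Nédélec functions of the first family, `a + b [x₂, -x₁]ᵗ`. -/
def nedelec : Set (Plane → Plane) :=
  {v | ∃ (a : Plane) (b : ℝ), ∀ x, v x = a + b • !₂[x 1, -x 0]}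

/-- The scalar polynomials of degree at most one. -/
def affineFun : Set (Plane → ℝ) :=
  {p | ∃ (a : Plane) (c : ℝ), ∀ x, p x = inner ℝ a x + c}

/-- The classical scalar curl `∂₁ v₂ - ∂₂ v₁`. -/
def curl (v : Plane → Plane) (x : Plane) : ℝ :=
  (fderiv ℝ v x (EuclideanSpace.single 0 1)) 1 - (fderiv ℝ v x (EuclideanSpace.single 1 1)) 0

/-- A normal vector to the segment from `D` to `E`. Only the vanishing of jumps is imposed below, so
that the vector need not be normalized. -/
def chordNormal (D E : Plane) : Plane := !₂[(E - D) 1, -(E - D) 0]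

open Classical in
/-- The local `H(curl)` IFE space: the Nédélec space on a non-interface element; on an interface
element the piecewise Nédélec functions which satisfy the three jump conditions at the midpoint of
the chord. (The value on the chord itself is immaterial.) -/
def localIND (T : Finset Plane) : Set (Plane → Plane) :=
  {f | (¬ P.IsInterface T ∧ ∃ v ∈ nedelec, ∀ x ∈ triangle T, f x = v x) ∨
    (P.IsInterface T ∧ ∃ D E, P.IsCut T D E ∧ ∃ vm ∈ nedelec, ∃ vp ∈ nedelec,
      inner ℝ (vp (midpoint ℝ D E)) (E - D) = inner ℝ (vm (midpoint ℝ D E)) (E - D) ∧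
      P.μp⁻¹ * curl vp (midpoint ℝ D E) = P.μm⁻¹ * curl vm (midpoint ℝ D E) ∧
      P.βp * inner ℝ (vp (midpoint ℝ D E)) (chordNormal D E) =
        P.βm * inner ℝ (vm (midpoint ℝ D E)) (chordNormal D E) ∧
      ∀ x ∈ triangle T, f x = if x ∈ subElement T D E P.Ωm then vm x else vp x)}

open Classical in
/-- The local `H¹` IFE space: linear polynomials on a non-interface element; on an interface
element the piecewise linear functions which are continuous across the chord and have continuous
flux `β ∇z · n` there. -/
def localS (T : Finset Plane) : Set (Plane → ℝ) :=
  {f | (¬ P.IsInterface T ∧ ∃ p ∈ affineFun, ∀ x ∈ triangle T, f x = p x) ∨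
    (P.IsInterface T ∧ ∃ D E, P.IsCut T D E ∧ ∃ pm ∈ affineFun, ∃ pp ∈ affineFun,
      (∀ x ∈ segment ℝ D E, pp x = pm x) ∧
      (∀ x ∈ segment ℝ D E, P.βm * inner ℝ (gradient pm x) (chordNormal D E) =
        P.βp * inner ℝ (gradient pp x) (chordNormal D E)) ∧
      ∀ x ∈ triangle T, f x = if x ∈ subElement T D E P.Ωm then pm x else pp x)}

/-- The tangential line integral `∫_e f · t ds` over the edge `e` from `a` to `b`. -/
def edgeIntegral (f : Plane → Plane) (a b : Plane) : ℝ :=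
  ∫ r in (0 : ℝ)..1, inner ℝ (f (AffineMap.lineMap a b r)) (b - a)

/-- Square integrable scalar functions on `Ω`. -/
abbrev ScalarL2 := Lp ℝ 2 (volume.restrict P.Ω)

/-- Square integrable vector fields on `Ω`. -/
abbrev VectorL2 := Lp Plane 2 (volume.restrict P.Ω)

/-- The global `H(curl)` IFE space with zero boundary trace: on each element a local IFE function
(`f T` below), with equal tangential integrals over the common edge of two elements, and with zero
tangential trace on the boundary edges. -/
def IND0 : Set P.VectorL2 :=
  {z | ∃ f : Finset Plane → Plane → Plane,
    (∀ T ∈ P.elements, f T ∈ P.localIND T ∧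
      z =ᵐ[volume.restrict (interior (triangle T))] f T) ∧
    (∀ T ∈ P.elements, ∀ T' ∈ P.elements, ∀ a b, a ∈ T → a ∈ T' → b ∈ T → b ∈ T' → a ≠ b →
      edgeIntegral (f T) a b = edgeIntegral (f T') a b) ∧
    (∀ T ∈ P.elements, ∀ a ∈ T, ∀ b ∈ T, a ≠ b → segment ℝ a b ⊆ frontier P.Ω →
      ∀ x ∈ segment ℝ a b, inner ℝ (f T x) (b - a) = 0)}

/-- The global `H¹` IFE space with zero boundary trace: on each element a local IFE function
(`f T` below), continuous at the mesh nodes, and vanishing on the boundary of `Ω`. -/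
def S0 : Set P.ScalarL2 :=
  {s | ∃ f : Finset Plane → Plane → ℝ,
    (∀ T ∈ P.elements, f T ∈ P.localS T ∧
      s =ᵐ[volume.restrict (interior (triangle T))] f T) ∧
    (∀ T ∈ P.elements, ∀ T' ∈ P.elements, ∀ A, A ∈ T → A ∈ T' → f T A = f T' A) ∧
    (∀ T ∈ P.elements, ∀ x ∈ triangle T, x ∈ frontier P.Ω → f T x = 0)}

/-- The space of functions that are constant on each non-interface element and on each of the two
subelements of each interface element. -/
def Qh : Set P.ScalarL2 :=
  {q | ∀ T ∈ P.elements,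
    (¬ P.IsInterface T → ∃ c : ℝ, ∀ᵐ x ∂volume.restrict (interior (triangle T)), q x = c) ∧
    (∀ D E, P.IsInterface T → P.IsCut T D E → ∀ U, U = P.Ωm ∨ U = P.Ωp →
      ∃ c : ℝ, ∀ᵐ x ∂volume.restrict (interior (subElement T D E U)), q x = c)}

/-- Smooth test functions with compact support in the interior of the element `T`. -/
def testFun (T : Finset Plane) : Set (Plane → ℝ) :=
  {φ | ContDiff ℝ ∞ φ ∧ HasCompactSupport φ ∧ tsupport φ ⊆ interior (triangle T)}

/-- The partial derivative `∂ᵢ φ`. -/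
def partialDeriv (i : Fin 2) (φ : Plane → ℝ) (x : Plane) : ℝ :=
  fderiv ℝ φ x (EuclideanSpace.single i 1)

/-- `g` is the elementwise (weak) gradient of `s`. -/
def IsElementwiseGrad (s : P.ScalarL2) (g : P.VectorL2) : Prop :=
  ∀ T ∈ P.elements, ∀ φ ∈ testFun T, ∀ i : Fin 2,
    ∫ x in interior (triangle T), s x * partialDeriv i φ x =
      -∫ x in interior (triangle T), (g x) i * φ x

/-- `q` is the elementwise (weak) curl `∂₁ z₂ - ∂₂ z₁` of `z`. -/
def IsElementwiseCurl (z : P.VectorL2) (q : P.ScalarL2) : Prop :=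
  ∀ T ∈ P.elements, ∀ φ ∈ testFun T,
    ∫ x in interior (triangle T), ((z x) 1 * partialDeriv 0 φ x - (z x) 0 * partialDeriv 1 φ x) =
      -∫ x in interior (triangle T), q x * φ x

end IFEData

end

/-! Locally, the tangential component of a Nédélec function is constant along any line. Matching it
at the midpoint of the chord therefore matches it on the whole chord, so the weak curl of a function
in `localIND` has no part concentrated there: it is the constant `-2 * b` on each side
(`Piece.weakCurl`). If this curl vanishes, one of the two coefficients `b` is zero, and the jump
condition on `μ⁻¹ curl` makes the other zero too. The field is then constant on each side, and its
jump is a multiple `κ` of the chord normal. It is the gradient of an affine function plus `κ` times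
the chord form on one side, and the flux condition on the field is exactly the flux condition on
this potential (`exists_weakCurl_of_mem_localIND`). Conversely, functions in `localS` have such
gradients (`exists_gradPair_of_mem_localS`). The relation is recorded by `GradPair`, which gives the
weak gradient, the vanishing weak curl and the fundamental theorem of calculus along segments.

Globally, the edge integrals of a curl-free field are differences of vertex values of its local
potentials, so these differences agree on shared edges and vanish on boundary edges. What remains is
to choose one constant per element so that the vertex values match (`exists_potential`). Simple
connectedness is not used through homotopies. Since the increments vanish along the boundary, they
extend by zero to the whole plane and stay locally consistent. On a large square, local potentials
glue to a global one by subdividing into a grid (`exists_hasLocalIncrements_planeRect`). The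
resulting potential is locally constant on the boundary, hence constant because the boundary is
connected, and it can be normalized to zero there.

The geometric input is that each part of an interface element agrees, off the chord, with a set
described by the sign of the chord form (`exists_splitBy`), including degenerate cases where the
chord ends at vertices; and that a boundary edge is never cut, since the interface stays inside the
open domain. -/

open Filter Topology

noncomputable section

/-! ### Gluing local potentials -/

section Glue

variable {X : Type*} [TopologicalSpace X] {δ : X → X → ℝ} {u v : X → ℝ} {A B S : Set X}

/-- Near every point of `S`, and within `S`, the increments of `u` are given by `δ`. -/
def HasLocalIncrements (δ : X → X → ℝ) (S : Set X) (u : X → ℝ) : Prop :=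
  ∀ x ∈ S, ∀ᶠ z in 𝓝[S] x, u z - u x = δ x z

theorem IsPreconnected.eq_of_eventually_eq {g : X → ℝ} (hS : IsPreconnected S)
    (h : ∀ x ∈ S, ∀ᶠ z in 𝓝[S] x, g z = g x) {x y : X} (hx : x ∈ S) (hy : y ∈ S) :
    g x = g y := by
  have hloc : IsLocallyConstant (fun z : S => g z) := by
    rw [IsLocallyConstant.iff_eventually_eq]
    intro z
    have := h z z.2
    rw [nhdsWithin_eq_map_subtype_coe z.2, eventually_map] at this
    exact this
  have : IsPreconnected (univ : Set S) :=
    preconnectedSpace_iff_univ.1 (isPreconnected_iff_preconnectedSpace.1 hS)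
  exact hloc.apply_eq_of_isPreconnected this (mem_univ ⟨x, hx⟩) (mem_univ ⟨y, hy⟩)

theorem HasLocalIncrements.mono (h : HasLocalIncrements δ B u) (hAB : A ⊆ B) :
    HasLocalIncrements δ A u :=
  fun x hx => (h x (hAB hx)).filter_mono (nhdsWithin_mono _ hAB)

theorem HasLocalIncrements.sub_eq (hu : HasLocalIncrements δ S u) (hv : HasLocalIncrements δ S v)
    (hS : IsPreconnected S) {x y : X} (hx : x ∈ S) (hy : y ∈ S) : u y - u x = v y - v x := by
  have := hS.eq_of_eventually_eq (g := fun z => u z - v z) (fun x hx => by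
    filter_upwards [hu x hx, hv x hx] with z h1 h2
    linarith) hx hy
  linarith

/-- On the connected overlap two potentials differ by a constant, so shifting one of them makes them
agree there. Closedness ensures that near a point outside one of the sets only the other set
matters. -/
theorem HasLocalIncrements.exists_union (hA : IsClosed A) (hB : IsClosed B)
    (hAB : IsPreconnected (A ∩ B)) (hne : (A ∩ B).Nonempty)
    (hu : ∃ u, HasLocalIncrements δ A u) (hv : ∃ v, HasLocalIncrements δ B v) :
    ∃ w, HasLocalIncrements δ (A ∪ B) w := by
  classical
  obtain ⟨u, hu⟩ := hu
  obtain ⟨v, hv⟩ := hv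
  obtain ⟨x₀, hx₀⟩ := hne
  set w : X → ℝ := fun x => if x ∈ A then u x else v x - v x₀ + u x₀ with hw
  have hwA : ∀ x ∈ A, w x = u x := fun x hx => by simp [hw, hx]
  have hwB : ∀ x ∈ B, w x = v x - v x₀ + u x₀ := fun x hx => by
    by_cases hxA : x ∈ A
    · have := (hu.mono inter_subset_left).sub_eq (hv.mono inter_subset_right) hAB hx₀ ⟨hxA, hx⟩
      rw [hwA x hxA]
      linarith
    · simp [hw, hxA]
  have hA' : HasLocalIncrements δ A w := fun x hx => by
    filter_upwards [hu x hx, self_mem_nhdsWithin] with z h1 h2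
    rw [hwA z h2, hwA x hx, h1]
  have hB' : HasLocalIncrements δ B w := fun x hx => by
    filter_upwards [hv x hx, self_mem_nhdsWithin] with z h1 h2
    rw [hwB z h2, hwB x hx, ← h1]
    ring
  refine ⟨w, fun x hx => ?_⟩
  rw [nhdsWithin_union, eventually_sup]
  have key : ∀ {C : Set X}, IsClosed C → HasLocalIncrements δ C w →
      ∀ᶠ z in 𝓝[C] x, w z - w x = δ x z := fun {C} hC h => by
    by_cases hxC : x ∈ C
    · exact h x hxC
    · rw [show 𝓝[C] x = ⊥ from notMem_closure_iff_nhdsWithin_eq_bot.1 (by rwa [hC.closure_eq])]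
      exact eventually_bot
  exact ⟨key hA hA', key hB hB'⟩

end Glue

/-! ### Coordinate rectangles and gluing over a square. -/

/-- The closed coordinate rectangle `[a, b] × [c, d]` in the plane. -/
def planeRect (a b c d : ℝ) : Set Plane := {x | x 0 ∈ Icc a b ∧ x 1 ∈ Icc c d}

theorem isClosed_planeRect (a b c d : ℝ) : IsClosed (planeRect a b c d) :=
  (isClosed_Icc.preimage (by fun_prop : Continuous fun x : Plane => x 0)).inter
    (isClosed_Icc.preimage (by fun_prop : Continuous fun x : Plane => x 1))

theorem convex_planeRect (a b c d : ℝ) : Convex ℝ (planeRect a b c d) := by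
  intro x hx y hy s t hs ht hst
  have h1 := convex_Icc a b hx.1 hy.1 hs ht hst
  have h2 := convex_Icc c d hx.2 hy.2 hs ht hst
  exact ⟨by simpa using h1, by simpa using h2⟩

theorem planeRect_nonempty {a b c d : ℝ} (h₁ : a ≤ b) (h₂ : c ≤ d) :
    (planeRect a b c d).Nonempty :=
  ⟨!₂[a, c], by simpa [planeRect] using ⟨h₁, h₂⟩⟩

theorem planeRect_union_left {a b c d e : ℝ} (h₁ : a ≤ b) (h₂ : b ≤ e) :
    planeRect a b c d ∪ planeRect b e c d = planeRect a e c d := by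
  ext x
  simp only [planeRect, mem_union, mem_ofPred_eq, mem_Icc]
  grind

theorem planeRect_union_right {a b c d e : ℝ} (h₁ : c ≤ d) (h₂ : d ≤ e) :
    planeRect a b c d ∪ planeRect a b d e = planeRect a b c e := by
  ext x
  simp only [planeRect, mem_union, mem_ofPred_eq, mem_Icc]
  grind

theorem planeRect_inter_left {a b c d e : ℝ} (h₁ : a ≤ b) (h₂ : b ≤ e) :
    planeRect a b c d ∩ planeRect b e c d = planeRect b b c d := by
  ext x
  simp only [planeRect, mem_inter_iff, mem_ofPred_eq, mem_Icc]
  grind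

theorem planeRect_inter_right {a b c d e : ℝ} (h₁ : c ≤ d) (h₂ : d ≤ e) :
    planeRect a b c d ∩ planeRect a b d e = planeRect a b d d := by
  ext x
  simp only [planeRect, mem_inter_iff, mem_ofPred_eq, mem_Icc]
  grind

theorem norm_le_add_abs (x : Plane) : ‖x‖ ≤ |x 0| + |x 1| := by
  rw [EuclideanSpace.norm_eq, Fin.sum_univ_two]
  refine Real.sqrt_le_iff.2 ⟨by positivity, ?_⟩
  simp only [Real.norm_eq_abs]
  nlinarith [abs_nonneg (x 0), abs_nonneg (x 1), mul_nonneg (abs_nonneg (x 0)) (abs_nonneg (x 1))]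

theorem isCompact_planeRect (a b c d : ℝ) : IsCompact (planeRect a b c d) := by
  refine Metric.isCompact_of_isClosed_isBounded (isClosed_planeRect a b c d) ?_
  refine isBounded_iff_forall_norm_le.2 ⟨max |a| |b| + max |c| |d|, fun x hx => ?_⟩
  exact (norm_le_add_abs x).trans
    (add_le_add (abs_le_max_abs_abs hx.1.1 hx.1.2) (abs_le_max_abs_abs hx.2.1 hx.2.2))

/-- Local potentials on a square glue to a global one. -/
theorem exists_hasLocalIncrements_planeRect {δ : Plane → Plane → ℝ}
    (hloc : ∀ x, ∃ U ∈ 𝓝 x, ∃ u, HasLocalIncrements δ U u) {R : ℝ} (hR : 0 < R) :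
    ∃ u, HasLocalIncrements δ (planeRect (-R) R (-R) R) u := by
  choose U hU hu using hloc
  obtain ⟨ε, hε, hleb⟩ := lebesgue_number_lemma_of_metric
    (isCompact_planeRect (-R) R (-R) R) (c := fun x => interior (U x)) (fun x => isOpen_interior)
    (fun x _ => mem_iUnion.2 ⟨x, mem_interior_iff_mem_nhds.2 (hU x)⟩)
  -- The cells have side `h = 2 * R / N`. This choice of `N` gives `h + h < ε`, so each cell lies in
  -- the `ε`-ball around its lower left corner and inside one of the given neighbourhoods.
  obtain ⟨N, hN⟩ := exists_nat_gt (4 * R / ε)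
  have hN0 : (0 : ℝ) < N := lt_of_le_of_lt (by positivity) hN
  set h : ℝ := 2 * R / N with hh
  have hh0 : 0 < h := by positivity
  have hNh : N * h = 2 * R := by rw [hh]; field_simp
  have hhε : h + h < ε := by
    rw [div_lt_iff₀ hε] at hN
    rw [← mul_lt_mul_iff_right₀ hN0]
    nlinarith
  have small : ∀ i < N, ∀ j < N, ∃ u, HasLocalIncrements δ
      (planeRect (-R + i * h) (-R + (i + 1) * h) (-R + j * h) (-R + (j + 1) * h)) u := by
    intro i hi j hj
    have hi' : ((i : ℝ) + 1) * h ≤ 2 * R := by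
      rw [← hNh]; gcongr; exact_mod_cast hi
    have hj' : ((j : ℝ) + 1) * h ≤ 2 * R := by
      rw [← hNh]; gcongr; exact_mod_cast hj
    have hi0 : 0 ≤ (i : ℝ) * h := by positivity
    have hj0 : 0 ≤ (j : ℝ) * h := by positivity
    obtain ⟨y, hy⟩ := hleb !₂[-R + i * h, -R + j * h] (by
      simp only [planeRect, mem_ofPred_eq, mem_Icc, Matrix.cons_val_zero,
        Matrix.cons_val_one]
      refine ⟨⟨?_, ?_⟩, ?_, ?_⟩ <;> linarith)
    obtain ⟨u, hu'⟩ := hu y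
    refine ⟨u, hu'.mono fun x hx => interior_subset (hy ?_)⟩
    rw [Metric.mem_ball, dist_eq_norm]
    refine (norm_le_add_abs _).trans_lt (lt_of_le_of_lt (add_le_add ?_ ?_) hhε)
    · have := hx.1
      simp only [mem_Icc] at this
      rw [abs_le]
      constructor <;> simp <;> linarith
    · have := hx.2
      simp only [mem_Icc] at this
      rw [abs_le]
      constructor <;> simp <;> linarith
  -- Cells are stacked into columns and columns are placed side by side. Each overlap is a
  -- degenerate rectangle, which is convex and so connected.
  have column : ∀ i < N, ∀ j ≤ N, 1 ≤ j → ∃ u, HasLocalIncrements δ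
      (planeRect (-R + i * h) (-R + (i + 1) * h) (-R) (-R + j * h)) u := by
    intro i hi j hj hj1
    induction j, hj1 using Nat.le_induction with
    | base => simpa using small i hi 0 (by omega)
    | succ j hj1 ih =>
      have h1 : -R ≤ -R + j * h := by have : 0 ≤ (j : ℝ) * h := by positivity
                                      linarith
      have h2 : -R + j * h ≤ -R + (j + 1) * h := by nlinarith
      have h3 : -R + i * h ≤ -R + (i + 1) * h := by nlinarith
      have := HasLocalIncrements.exists_union (isClosed_planeRect _ _ _ _)
        (isClosed_planeRect _ _ _ _)
        (by rw [planeRect_inter_right h1 h2]; exact (convex_planeRect _ _ _ _).isPreconnected)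
        (by rw [planeRect_inter_right h1 h2]; exact planeRect_nonempty h3 le_rfl)
        (ih (by omega)) (small i hi j (by omega))
      rw [planeRect_union_right h1 h2] at this
      simpa using this
  have all : ∀ i ≤ N, 1 ≤ i → ∃ u, HasLocalIncrements δ
      (planeRect (-R) (-R + i * h) (-R) R) u := by
    have hR' : -R + N * h = R := by rw [hNh]; ring
    have hN1 : 1 ≤ N := by exact_mod_cast Nat.one_le_iff_ne_zero.2 (by rintro rfl; simp at hN0)
    intro i hi hi1
    induction i, hi1 using Nat.le_induction with
    | base => simpa [hR'] using column 0 (by omega) N le_rfl hN1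
    | succ i hi1 ih =>
      have h1 : -R ≤ -R + i * h := by have : 0 ≤ (i : ℝ) * h := by positivity
                                      linarith
      have h2 : -R + i * h ≤ -R + (i + 1) * h := by nlinarith
      have hc := column i (by omega) N le_rfl hN1
      rw [hR'] at hc
      have := HasLocalIncrements.exists_union (isClosed_planeRect _ _ _ _)
        (isClosed_planeRect _ _ _ _)
        (by rw [planeRect_inter_left h1 h2]; exact (convex_planeRect _ _ _ _).isPreconnected)
        (by rw [planeRect_inter_left h1 h2]; exact planeRect_nonempty le_rfl (by linarith))
        (ih (by omega)) hc
      rw [planeRect_union_left h1 h2] at this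
      simpa using this
  have := all N le_rfl (by exact_mod_cast Nat.one_le_iff_ne_zero.2 (by rintro rfl; simp at hN0))
  rwa [hNh, show -R + 2 * R = R by ring] at this

/-! ### Barycentric coordinates of a triangle -/

theorem AffineMap.apply_eq_linear_add {V : Type*} [AddCommGroup V] [Module ℝ V] (g : V →ᵃ[ℝ] ℝ)
    (x : V) : g x = g.linear x + g 0 := by
  simpa using congrFun g.decomp x

/-- The affine functions `α`, `β`, `γ` are the barycentric coordinates of the triangle `p q r`. -/
structure IsBarycentric (p q r : Plane) (α β γ : Plane →ᵃ[ℝ] ℝ) : Prop where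
  sum_eq : ∀ x, α x + β x + γ x = 1
  comb_eq : ∀ x, α x • p + β x • q + γ x • r = x
  fst_fst : α p = 1
  fst_snd : α q = 0
  fst_trd : α r = 0
  snd_fst : β p = 0
  snd_snd : β q = 1
  snd_trd : β r = 0
  trd_fst : γ p = 0
  trd_snd : γ q = 0
  trd_trd : γ r = 1
  mem_iff : ∀ x, x ∈ convexHull ℝ ({p, q, r} : Set Plane) ↔ 0 ≤ α x ∧ 0 ≤ β x ∧ 0 ≤ γ x
  mem_interior_iff : ∀ x, x ∈ interior (convexHull ℝ ({p, q, r} : Set Plane)) ↔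
    0 < α x ∧ 0 < β x ∧ 0 < γ x

theorem AffineIndependent.exists_isBarycentric {p q r : Plane}
    (h : AffineIndependent ℝ ![p, q, r]) : ∃ α β γ, IsBarycentric p q r α β γ := by
  let b : AffineBasis (Fin 3) ℝ Plane := ⟨![p, q, r], h,
    h.affineSpan_eq_top_iff_card_eq_finrank_add_one.2 (by simp)⟩
  have h0 : b 0 = p := rfl
  have h1 : b 1 = q := rfl
  have h2 : b 2 = r := rfl
  have hr : range b = {p, q, r} := by
    have : (b : Fin 3 → Plane) = ![p, q, r] := rfl
    rw [this]
    ext x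
    simp [eq_comm]
    tauto
  refine ⟨b.coord 0, b.coord 1, b.coord 2, ?_, ?_, ?_, ?_, ?_, ?_, ?_, ?_, ?_, ?_, ?_, ?_, ?_⟩
  · intro x
    have := b.sum_coord_apply_eq_one x
    rwa [Fin.sum_univ_three] at this
  · intro x
    have := b.linear_combination_coord_eq_self x
    rwa [Fin.sum_univ_three] at this
  · rw [← h0, b.coord_apply]; simp
  · rw [← h1, b.coord_apply]; simp
  · rw [← h2, b.coord_apply]; simp
  · rw [← h0, b.coord_apply]; simp
  · rw [← h1, b.coord_apply]; simp
  · rw [← h2, b.coord_apply]; simp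
  · rw [← h0, b.coord_apply]; simp
  · rw [← h1, b.coord_apply]; simp
  · rw [← h2, b.coord_apply]; simp
  · intro x
    rw [← hr, b.convexHull_eq_nonneg_coord]
    simp [Fin.forall_fin_succ]
  · intro x
    rw [← hr, b.interior_convexHull]
    simp [Fin.forall_fin_succ]

namespace IsBarycentric

variable {p q r : Plane} {α β γ : Plane →ᵃ[ℝ] ℝ}

theorem affine_apply (h : IsBarycentric p q r α β γ) (g : Plane →ᵃ[ℝ] ℝ) (x : Plane) :
    g x = α x * g p + β x * g q + γ x * g r := by
  conv_lhs => rw [← h.comb_eq x]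
  rw [g.apply_eq_linear_add, g.apply_eq_linear_add p, g.apply_eq_linear_add q,
    g.apply_eq_linear_add r]
  simp only [map_add, map_smul, smul_eq_mul]
  linear_combination -(g 0) * h.sum_eq x

theorem mem_segment (h : IsBarycentric p q r α β γ) {x : Plane} (hα : 0 ≤ α x) (hβ : 0 ≤ β x)
    (hγ : γ x = 0) : x ∈ segment ℝ p q := by
  refine ⟨α x, β x, hα, hβ, ?_, ?_⟩
  · simpa [hγ] using h.sum_eq x
  · simpa [hγ] using h.comb_eq x

theorem trd_eq_zero (h : IsBarycentric p q r α β γ) {x : Plane} (hx : x ∈ segment ℝ p q) :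
    γ x = 0 := by
  obtain ⟨a, b, -, -, hab, rfl⟩ := hx
  rw [Convex.combo_affine_apply hab, h.trd_fst, h.trd_snd]
  simp

theorem pos_of_mem_openSegment (h : IsBarycentric p q r α β γ) {x : Plane}
    (hx : x ∈ openSegment ℝ p q) : 0 < α x ∧ 0 < β x := by
  obtain ⟨a, b, ha, hb, hab, rfl⟩ := hx
  rw [Convex.combo_affine_apply hab, Convex.combo_affine_apply hab, h.fst_fst, h.fst_snd,
    h.snd_fst, h.snd_snd]
  simpa using ⟨ha, hb⟩

/-- Cyclic symmetry carries the facts about the edge `p q` over to the other two edges. -/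
theorem rotate (h : IsBarycentric p q r α β γ) : IsBarycentric q r p β γ α where
  sum_eq x := by linarith [h.sum_eq x]
  comb_eq x := by rw [← add_rotate]; exact h.comb_eq x
  fst_fst := h.snd_snd
  fst_snd := h.snd_trd
  fst_trd := h.snd_fst
  snd_fst := h.trd_snd
  snd_snd := h.trd_trd
  snd_trd := h.trd_fst
  trd_fst := h.fst_snd
  trd_snd := h.fst_trd
  trd_trd := h.fst_fst
  mem_iff x := by
    rw [show ({q, r, p} : Set Plane) = {p, q, r} by ext; simp; tauto, h.mem_iff]; tauto
  mem_interior_iff x := by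
    rw [show ({q, r, p} : Set Plane) = {p, q, r} by ext; simp; tauto, h.mem_interior_iff]; tauto

end IsBarycentric

/-! ### The mesh and the boundary of the domain. -/

namespace IFEData

variable {P : IFEData} {T T' : Finset Plane} {a b x y : Plane}

theorem exists_isBarycentric (hT : T ∈ P.elements) {p q r : Plane}
    (hpq : p ≠ q) (hpr : p ≠ r) (hqr : q ≠ r) (h : T = {p, q, r}) :
    ∃ α β γ, IsBarycentric p q r α β γ := by
  have hi := P.mesh.indep hT.1
  have hp : p ∈ T := by simp [h]
  have hq : q ∈ T := by simp [h]
  have hr : r ∈ T := by simp [h]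
  let f : Fin 3 ↪ T := ⟨![⟨p, hp⟩, ⟨q, hq⟩, ⟨r, hr⟩], by
    intro i j hij
    fin_cases i <;> fin_cases j <;> simp_all⟩
  have := hi.comp_embedding f
  have e : ((↑) : T → Plane) ∘ f = ![p, q, r] := by
    ext i : 1
    fin_cases i <;> rfl
  rw [e] at this
  exact this.exists_isBarycentric

theorem exists_third_vertex (hT : T ∈ P.elements) (ha : a ∈ T) (hb : b ∈ T) (hab : a ≠ b) :
    ∃ c, a ≠ c ∧ b ≠ c ∧ T = {a, b, c} := by
  obtain ⟨x, y, z, hxy, hxz, hyz, rfl⟩ := Finset.card_eq_three.1 hT.2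
  simp only [Finset.mem_insert, Finset.mem_singleton] at ha hb
  rcases ha with rfl | rfl | rfl <;> rcases hb with rfl | rfl | rfl
  any_goals exact absurd rfl hab
  · exact ⟨z, hxz, hyz, rfl⟩
  · exact ⟨y, hxy, hyz.symm, by ext; simp; tauto⟩
  · exact ⟨z, hyz, hxz, by ext; simp; tauto⟩
  · exact ⟨x, hxy.symm, hxz.symm, by ext; simp; tauto⟩
  · exact ⟨y, hyz.symm, hxy, by ext; simp; tauto⟩
  · exact ⟨x, hxz.symm, hxy.symm, by ext; simp; tauto⟩

/-- An element with two chosen vertices, with its barycentric coordinates. -/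
theorem exists_coords (hT : T ∈ P.elements) (ha : a ∈ T) (hb : b ∈ T) (hab : a ≠ b) :
    ∃ c, a ≠ c ∧ b ≠ c ∧ T = {a, b, c} ∧ triangle T = convexHull ℝ {a, b, c} ∧
      ∃ α β γ, IsBarycentric a b c α β γ := by
  obtain ⟨c, hac, hbc, h⟩ := exists_third_vertex hT ha hb hab
  exact ⟨c, hac, hbc, h, by rw [triangle, h]; simp, exists_isBarycentric hT hab hac hbc h⟩

theorem exists_coords' (hT : T ∈ P.elements) :
    ∃ a b c, a ≠ b ∧ a ≠ c ∧ b ≠ c ∧ T = {a, b, c} ∧ triangle T = convexHull ℝ {a, b, c} ∧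
      ∃ α β γ, IsBarycentric a b c α β γ := by
  obtain ⟨x, y, z, hxy, hxz, hyz, rfl⟩ := Finset.card_eq_three.1 hT.2
  obtain ⟨c, h⟩ := exists_coords hT (a := x) (b := y) (by simp) (by simp) hxy
  exact ⟨x, y, c, hxy, h⟩

theorem convex_triangle (T : Finset Plane) : Convex ℝ (triangle T) := convex_convexHull ℝ _

theorem isCompact_triangle (T : Finset Plane) : IsCompact (triangle T) :=
  T.finite_toSet.isCompact_convexHull ℝ

theorem isClosed_triangle (T : Finset Plane) : IsClosed (triangle T) :=
  (isCompact_triangle T).isClosed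

theorem mem_triangle (ha : a ∈ T) : a ∈ triangle T := subset_convexHull ℝ _ ha

theorem segment_subset_triangle (ha : a ∈ T) (hb : b ∈ T) : segment ℝ a b ⊆ triangle T :=
  (convex_triangle T).segment_subset (mem_triangle ha) (mem_triangle hb)

theorem interior_triangle_nonempty (hT : T ∈ P.elements) : (interior (triangle T)).Nonempty := by
  rw [triangle, interior_convexHull_nonempty_iff_affineSpan_eq_top]
  have := (P.mesh.indep hT.1).affineSpan_eq_top_iff_card_eq_finrank_add_one.2
    (by simp [hT.2])
  simpa using this

theorem closure_interior_triangle (hT : T ∈ P.elements) :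
    closure (interior (triangle T)) = triangle T := by
  rw [(convex_triangle T).closure_interior_eq_closure_of_nonempty_interior
    (interior_triangle_nonempty hT), (isClosed_triangle T).closure_eq]

theorem triangle_subset_space (hT : T ∈ P.elements) : triangle T ⊆ P.mesh.space :=
  Geometry.SimplicialComplex.convexHull_subset_space hT.1

theorem exists_mem_triangle (hP : P.IsAdmissible) (hx : x ∈ P.mesh.space) :
    ∃ T ∈ P.elements, x ∈ triangle T := by
  obtain ⟨s, hs, hxs⟩ := Geometry.SimplicialComplex.mem_space_iff.1 hx
  obtain ⟨T, hT, hsT⟩ := hP.mesh_pure s hs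
  exact ⟨T, hT, convexHull_mono (Finset.coe_subset.2 hsT) hxs⟩

theorem finite_elements (hP : P.IsAdmissible) : P.elements.Finite :=
  hP.mesh_finite.subset fun _ h => h.1

theorem interior_triangle_subset (hP : P.IsAdmissible) (hT : T ∈ P.elements) :
    interior (triangle T) ⊆ P.Ω := by
  rw [← hP.mesh_interior]
  exact interior_mono (triangle_subset_space hT)

theorem edge_mem_faces (hT : T ∈ P.elements) (ha : a ∈ T) (hb : b ∈ T) :
    ({a, b} : Finset Plane) ∈ P.mesh.faces :=
  P.mesh.down_closed hT.1 (by simp [Finset.insert_subset_iff, ha, hb]) (by simp)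

theorem triangle_inter_subset (hT : T ∈ P.elements) (hT' : T' ∈ P.elements) :
    triangle T ∩ triangle T' ⊆ convexHull ℝ ((T : Set Plane) ∩ T') :=
  P.mesh.inter_subset_convexHull hT.1 hT'.1

/-- An element that meets an edge in a relatively interior point contains the edge. -/
theorem mem_of_mem_openSegment (hT : T ∈ P.elements) (ha : a ∈ T) (hb : b ∈ T) (hab : a ≠ b)
    (hx : x ∈ openSegment ℝ a b) (hT' : T' ∈ P.elements) (hxT' : x ∈ triangle T') :
    a ∈ T' ∧ b ∈ T' := by
  have hx' : x ∈ convexHull ℝ ((({a, b} : Finset Plane) : Set Plane) ∩ T') :=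
    P.mesh.inter_subset_convexHull (edge_mem_faces hT ha hb) hT'.1
      ⟨by simpa [convexHull_pair] using openSegment_subset_segment ℝ _ _ hx, hxT'⟩
  by_contra hcon
  rw [not_and_or] at hcon
  have hxa : x ≠ a := by
    rintro rfl
    exact hab (left_mem_openSegment_iff.1 hx)
  have hxb : x ≠ b := by
    rintro rfl
    exact hab (right_mem_openSegment_iff.1 hx)
  rcases hcon with h | h
  · have : x ∈ convexHull ℝ ({b} : Set Plane) := by
      refine convexHull_mono ?_ hx'
      rintro y ⟨hy, hy'⟩
      simp only [Finset.coe_insert, Finset.coe_singleton, mem_insert_iff, mem_singleton_iff] at hy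
      rcases hy with rfl | rfl
      · exact absurd hy' h
      · rfl
    rw [convexHull_singleton] at this
    exact hxb this
  · have : x ∈ convexHull ℝ ({a} : Set Plane) := by
      refine convexHull_mono ?_ hx'
      rintro y ⟨hy, hy'⟩
      simp only [Finset.coe_insert, Finset.coe_singleton, mem_insert_iff, mem_singleton_iff] at hy
      rcases hy with rfl | rfl
      · rfl
      · exact absurd hy' h
    rw [convexHull_singleton] at this
    exact hxa this

theorem eventually_mem_triangle (hP : P.IsAdmissible) (x : Plane) :
    ∀ᶠ z in 𝓝 x, ∀ T ∈ P.elements, z ∈ triangle T → x ∈ triangle T := by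
  rw [eventually_all_finite (finite_elements hP)]
  intro T _
  by_cases hx : x ∈ triangle T
  · exact Eventually.of_forall fun _ _ => hx
  · filter_upwards [(isClosed_triangle T).isOpen_compl.mem_nhds hx] with z hz hz'
    exact absurd hz' hz

theorem mem_boundary_edge (hT : T ∈ P.elements) (hx : x ∈ triangle T)
    (hx' : x ∉ interior (triangle T)) :
    ∃ a ∈ T, ∃ b ∈ T, a ≠ b ∧ x ∈ segment ℝ a b := by
  obtain ⟨a, b, c, hab, hac, hbc, h, htri, α, β, γ, hc⟩ := exists_coords' hT
  rw [htri] at hx hx'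
  obtain ⟨h1, h2, h3⟩ := (hc.mem_iff x).1 hx
  rw [hc.mem_interior_iff] at hx'
  by_cases hα : α x = 0
  · exact ⟨b, by simp [h], c, by simp [h], hbc, hc.rotate.mem_segment h2 h3 hα⟩
  by_cases hβ : β x = 0
  · exact ⟨c, by simp [h], a, by simp [h], hac.symm, hc.rotate.rotate.mem_segment h3 h1 hβ⟩
  by_cases hγ : γ x = 0
  · exact ⟨a, by simp [h], b, by simp [h], hab, hc.mem_segment h1 h2 hγ⟩
  exact absurd ⟨h1.lt_of_ne' hα, h2.lt_of_ne' hβ, h3.lt_of_ne' hγ⟩ hx'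

theorem space_eq_union (hP : P.IsAdmissible) : P.mesh.space = P.Ω ∪ frontier P.Ω := by
  rw [hP.mesh_space, closure_eq_self_union_frontier]

theorem triangle_subset_union (hP : P.IsAdmissible) (hT : T ∈ P.elements) :
    triangle T ⊆ P.Ω ∪ frontier P.Ω :=
  (triangle_subset_space hT).trans (space_eq_union hP).subset

theorem disjoint_frontier (hP : P.IsAdmissible) : Disjoint P.Ω (frontier P.Ω) :=
  disjoint_iff_inter_eq_empty.2 hP.isOpen_Ω.inter_frontier_eq

/-- An open edge that contains a boundary point lies in the boundary. -/
theorem segment_subset_frontier (hP : P.IsAdmissible) (hT : T ∈ P.elements) (ha : a ∈ T)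
    (hb : b ∈ T) (hab : a ≠ b) (hx : x ∈ openSegment ℝ a b) (hxf : x ∈ frontier P.Ω) :
    segment ℝ a b ⊆ frontier P.Ω := by
  rw [← closure_openSegment]
  refine closure_minimal (fun y hy => ?_) isClosed_frontier
  refine (triangle_subset_union hP hT (segment_subset_triangle ha hb
    (openSegment_subset_segment ℝ _ _ hy))).resolve_left fun hyΩ => ?_
  obtain ⟨c, hac, hbc, h, htri, α, β, γ, hc⟩ := exists_coords hT ha hb hab
  -- a point near `y` on the other side of the edge
  obtain ⟨z, hz, hzT, hzy⟩ : ∃ z, γ z < 0 ∧ z ∈ P.Ω ∧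
      ∀ T ∈ P.elements, z ∈ triangle T → y ∈ triangle T := by
    have hcont : Tendsto (fun t : ℝ => AffineMap.lineMap y c t) (𝓝[<] 0) (𝓝 y) := by
      have : Continuous (fun t : ℝ => AffineMap.lineMap (k := ℝ) y c t) := by fun_prop
      have h0 := this.tendsto 0
      simp only [AffineMap.lineMap_apply_zero] at h0
      exact h0.mono_left nhdsWithin_le_nhds
    have h1 := hcont.eventually ((hP.isOpen_Ω.eventually_mem hyΩ).and
      (eventually_mem_triangle hP y))
    obtain ⟨t, ⟨ht1, ht2⟩, ht⟩ := (h1.and self_mem_nhdsWithin).exists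
    refine ⟨_, ?_, ht1, ht2⟩
    rw [AffineMap.apply_lineMap, hc.trd_eq_zero (openSegment_subset_segment ℝ _ _ hy), hc.trd_trd]
    simpa [AffineMap.lineMap_apply] using ht
  obtain ⟨T', hT', hzT'⟩ := exists_mem_triangle hP (interior_subset (hP.mesh_interior ▸ hzT))
  obtain ⟨ha', hb'⟩ := mem_of_mem_openSegment hT ha hb hab hy hT' (hzy T' hT' hzT')
  obtain ⟨c', hac', hbc', h', htri', α', β', γ', hc'⟩ := exists_coords hT' ha' hb' hab
  -- Both third coordinates vanish on the common edge, so they are proportional. The point `z` has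
  -- `γ z < 0 ≤ γ' z`, which forces `γ' c ≤ 0`: the element `T'` lies across the edge from `T`.
  have hγ : ∀ w, γ' w = γ w * γ' c := fun w => by
    rw [hc.affine_apply γ' w, hc'.trd_fst, hc'.trd_snd]
    ring
  have hk : γ' c ≤ 0 := by
    rw [htri', hc'.mem_iff, hγ] at hzT'
    nlinarith [hzT'.2.2]
  -- The two elements on either side of the edge cover a neighbourhood of `x`, so `x` would be
  -- interior to the mesh, that is, in `Ω`.
  have hcover : ∀ᶠ w in 𝓝 x, w ∈ P.mesh.space := by
    obtain ⟨p1, p2⟩ := hc.pos_of_mem_openSegment hx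
    obtain ⟨p3, p4⟩ := hc'.pos_of_mem_openSegment hx
    have e : ∀ g : Plane →ᵃ[ℝ] ℝ, 0 < g x → ∀ᶠ w in 𝓝 x, 0 < g w := fun g hg =>
      (g.continuous_of_finiteDimensional.tendsto x).eventually (lt_mem_nhds hg)
    filter_upwards [e _ p1, e _ p2, e _ p3, e _ p4] with w w1 w2 w3 w4
    rcases le_total 0 (γ w) with hw | hw
    · refine triangle_subset_space hT ?_
      rw [htri, hc.mem_iff]
      exact ⟨w1.le, w2.le, hw⟩
    · refine triangle_subset_space hT' ?_
      rw [htri', hc'.mem_iff]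
      exact ⟨w3.le, w4.le, by rw [hγ]; nlinarith⟩
  have : x ∈ P.Ω := by
    rw [← hP.mesh_interior]
    exact mem_interior_iff_mem_nhds.2 hcover
  exact (disjoint_frontier hP).le_bot ⟨this, hxf⟩

/-- The plane minus a point is connected. If the boundary had at most one point, `Ω` would fill the
rest of the plane, contrary to boundedness. -/
theorem frontier_nontrivial (hP : P.IsAdmissible) : (frontier P.Ω).Nontrivial := by
  obtain ⟨y, hy⟩ := hP.isConnected_boundary.nonempty
  by_contra hcon
  have hsub : frontier P.Ω ⊆ {y} := fun z hz =>
    not_not.1 fun hzy => hcon ⟨z, hz, y, hy, hzy⟩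
  have hrank : 1 < Module.rank ℝ Plane := by
    rw [← Module.finrank_eq_rank]
    simp
  have hconn := (isConnected_compl_singleton_of_one_lt_rank hrank y).isPreconnected
  have hΩy : P.Ω ⊆ {y}ᶜ := fun z hz hzy => (disjoint_frontier hP).le_bot
    ⟨hz, by rw [mem_singleton_iff] at hzy; rwa [hzy]⟩
  have hcover : {y}ᶜ ⊆ P.Ω ∪ (closure P.Ω)ᶜ := fun z hz => by
    by_contra h
    simp only [mem_union, mem_compl_iff, not_or, not_not] at h
    rw [closure_eq_self_union_frontier] at h
    exact hz (hsub (h.2.resolve_left h.1))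
  have hsubset : {y}ᶜ ⊆ P.Ω := by
    refine hconn.subset_left_of_subset_union hP.isOpen_Ω isClosed_closure.isOpen_compl
      (disjoint_compl_right.mono_left subset_closure) hcover ?_
    obtain ⟨z, hz⟩ := hP.isConnected_Ω.nonempty
    exact ⟨z, hΩy hz, hz⟩
  have hb : Bornology.IsBounded (univ : Set Plane) := by
    rw [← union_compl_self {y}]
    exact Bornology.isBounded_singleton.union (hP.isBounded_Ω.subset hsubset)
  exact NormedSpace.unbounded_univ ℝ Plane hb

/-- The boundary is a union of edges of the mesh. -/
theorem exists_boundary_edge (hP : P.IsAdmissible) (hx : x ∈ frontier P.Ω) :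
    ∃ T ∈ P.elements, ∃ a ∈ T, ∃ b ∈ T, a ≠ b ∧ segment ℝ a b ⊆ frontier P.Ω ∧
      x ∈ segment ℝ a b := by
  set V : Set Plane := ⋃ T ∈ P.elements, (T : Set Plane) with hV
  have hVfin : V.Finite := (finite_elements hP).biUnion fun T _ => T.finite_toSet
  set I : Set (Plane × Plane) := {e | e ∈ V ×ˢ V ∧ (∃ T ∈ P.elements, e.1 ∈ T ∧ e.2 ∈ T) ∧
    e.1 ≠ e.2 ∧ segment ℝ e.1 e.2 ⊆ frontier P.Ω} with hI
  have hIfin : I.Finite := (hVfin.prod hVfin).subset fun e he => he.1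
  set S : Set Plane := ⋃ e ∈ I, segment ℝ e.1 e.2 with hS
  have hSclosed : IsClosed S := hIfin.isClosed_biUnion fun e _ => by
    rw [← closure_openSegment]
    exact isClosed_closure
  -- A connected set with more than one point has no isolated points, so removing the finitely many
  -- vertices leaves a dense subset. Boundary points other than vertices lie on boundary edges, and
  -- the union `S` of those is closed.
  have hdense : frontier P.Ω ⊆ closure (frontier P.Ω \ V) := by
    have hpre := hP.isConnected_boundary.isPreconnected.preperfect_of_nontrivial
      (frontier_nontrivial hP)
    intro z hz
    have hacc := hpre z hz
    rw [mem_closure_iff_frequently]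
    rw [accPt_iff_frequently] at hacc
    have hfin : ∀ᶠ w in 𝓝 z, w ≠ z → w ∉ V := by
      have := (hVfin.subset (sdiff_subset (t := {z}))).isClosed.isOpen_compl.mem_nhds
        (show z ∈ (V \ {z})ᶜ from fun h => h.2 rfl)
      filter_upwards [this] with w hw hwz hwV
      exact hw ⟨hwV, hwz⟩
    exact (hacc.and_eventually hfin).mono fun w hw => ⟨hw.1.2, hw.2 hw.1.1⟩
  have hsub : frontier P.Ω \ V ⊆ S := by
    rintro z ⟨hz, hzV⟩
    obtain ⟨T, hT, hzT⟩ := exists_mem_triangle hP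
      (by rw [space_eq_union hP]; exact Or.inr hz : z ∈ P.mesh.space)
    obtain ⟨a, ha, b, hb, hab, hzab⟩ := mem_boundary_edge hT hzT fun h =>
      (disjoint_frontier hP).le_bot ⟨interior_triangle_subset hP hT h, hz⟩
    have haV : a ∈ V := mem_biUnion hT ha
    have hbV : b ∈ V := mem_biUnion hT hb
    have hz' : z ∈ openSegment ℝ a b := mem_openSegment_of_ne_left_right
      (by rintro rfl; exact hzV haV) (by rintro rfl; exact hzV hbV) hzab
    exact mem_biUnion (x := (a, b)) ⟨⟨haV, hbV⟩, ⟨T, hT, ha, hb⟩, hab,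
      segment_subset_frontier hP hT ha hb hab hz' hz⟩ hzab
  have := closure_minimal hsub hSclosed (hdense hx)
  simp only [hS, mem_iUnion] at this
  obtain ⟨e, ⟨-, ⟨T, hT, h1, h2⟩, h3, h4⟩, h5⟩ := this
  exact ⟨T, hT, e.1, h1, e.2, h2, h3, h4, h5⟩

variable {P : IFEData} {T T' : Finset Plane} {a b x y : Plane}

/-! ### Discrete potentials -/

theorem affine_eq_of_mem_convexHull {s : Set Plane} (g : Plane →ᵃ[ℝ] ℝ)
    (hg : ∀ a ∈ s, ∀ b ∈ s, g a = g b) (hx : x ∈ convexHull ℝ s) (hy : y ∈ convexHull ℝ s) :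
    g x = g y := by
  obtain ⟨a, ha⟩ := convexHull_nonempty_iff.1 ⟨x, hx⟩
  have key : ∀ z ∈ convexHull ℝ s, g z = g a := fun z hz =>
    convexHull_min (t := g ⁻¹' {g a}) (fun w hw => hg w hw a ha)
      ((convex_singleton _).affine_preimage g) hz
  rw [key x hx, key y hy]

open Classical in
/-- The increment from `x` to `y` of a piecewise affine function given by `A T` on the element `T`,
extended by zero to pairs of points that lie in no common element. -/
def increment (P : IFEData) (A : Finset Plane → Plane →ᵃ[ℝ] ℝ) (x y : Plane) : ℝ :=
  if h : ∃ T ∈ P.elements, x ∈ triangle T ∧ y ∈ triangle T then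
    A h.choose y - A h.choose x else 0

variable {A : Finset Plane → Plane →ᵃ[ℝ] ℝ}

/-- Two elements containing both points meet in the convex hull of their common vertices. There the
difference of the two affine functions is constant, because it has equal values at the common
vertices; the element chosen in `increment` is thus immaterial. -/
theorem increment_eq
    (hA : ∀ T ∈ P.elements, ∀ T' ∈ P.elements, ∀ a b, a ∈ T → a ∈ T' → b ∈ T → b ∈ T' →
      A T b - A T a = A T' b - A T' a)
    (hT : T ∈ P.elements) (hx : x ∈ triangle T) (hy : y ∈ triangle T) :
    P.increment A x y = A T y - A T x := by
  have h : ∃ T ∈ P.elements, x ∈ triangle T ∧ y ∈ triangle T := ⟨T, hT, hx, hy⟩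
  obtain ⟨hT', hx', hy'⟩ := h.choose_spec
  rw [increment, dif_pos h]
  have := affine_eq_of_mem_convexHull (A h.choose - A T) (fun a ha b hb => by
    have := hA T hT _ hT' a b ha.2 ha.1 hb.2 hb.1
    simp only [AffineMap.coe_sub, Pi.sub_apply]
    linarith) (triangle_inter_subset hT' hT ⟨hx', hx⟩) (triangle_inter_subset hT' hT ⟨hy', hy⟩)
  simp only [AffineMap.coe_sub, Pi.sub_apply] at this
  linarith

theorem increment_eq_zero (h : ∀ T ∈ P.elements, y ∉ triangle T) : P.increment A x y = 0 := by
  rw [increment, dif_neg]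
  rintro ⟨T, hT, -, hy⟩
  exact h T hT hy

/-- Elementwise affine functions that have the same increments along common edges and are constant
on boundary edges differ by elementwise constants from a function that vanishes on the boundary. -/
theorem exists_potential (hP : P.IsAdmissible)
    (hA : ∀ T ∈ P.elements, ∀ T' ∈ P.elements, ∀ a b, a ∈ T → a ∈ T' → b ∈ T → b ∈ T' →
      A T b - A T a = A T' b - A T' a)
    (hbd : ∀ T ∈ P.elements, ∀ a ∈ T, ∀ b ∈ T, a ≠ b → segment ℝ a b ⊆ frontier P.Ω →
      A T b = A T a) :
    ∃ u : Plane → ℝ, (∀ T ∈ P.elements, ∀ a ∈ T, ∀ b ∈ T, u b - u a = A T b - A T a) ∧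
      ∀ x ∈ frontier P.Ω, u x = 0 := by
  classical
  -- near a boundary point, the increments vanish on the boundary
  have hzero : ∀ x ∈ frontier P.Ω, ∀ᶠ y in 𝓝 x, y ∈ frontier P.Ω → P.increment A x y = 0 := by
    intro x hx
    have : ∀ᶠ y in 𝓝 x, ∀ T ∈ P.elements, ∀ a ∈ T, ∀ b ∈ T, y ∈ segment ℝ a b →
        x ∈ segment ℝ a b := by
      rw [eventually_all_finite (finite_elements hP)]
      intro T _
      rw [eventually_all_finset]
      intro a _
      rw [eventually_all_finset]
      intro b _
      by_cases h : x ∈ segment ℝ a b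
      · exact Eventually.of_forall fun _ _ => h
      · have hc : IsClosed (segment ℝ a b) := by
          rw [← closure_openSegment]
          exact isClosed_closure
        filter_upwards [hc.isOpen_compl.mem_nhds h] with z hz hz'
        exact absurd hz' hz
    filter_upwards [this] with y hy hyf
    obtain ⟨T, hT, a, ha, b, hb, hab, hf, hyab⟩ := exists_boundary_edge hP hyf
    have hxab := hy T hT a ha b hb hyab
    rw [increment_eq hA hT (segment_subset_triangle ha hb hxab)
      (segment_subset_triangle ha hb hyab)]
    rw [← convexHull_pair] at hxab hyab
    have hE := hbd T hT a ha b hb hab hf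
    rw [affine_eq_of_mem_convexHull (A T) (by simp [hE]) hyab hxab, sub_self]
  have hloc : ∀ x, ∃ U ∈ 𝓝 x, ∃ u, HasLocalIncrements (P.increment A) U u := by
    intro x
    have hU : ∀ᶠ y in 𝓝 x, (∀ T ∈ P.elements, y ∈ triangle T → x ∈ triangle T) ∧
        (x ∈ P.Ω → y ∈ P.Ω) ∧
        (x ∈ frontier P.Ω → y ∈ frontier P.Ω → P.increment A x y = 0) := by
      refine (eventually_mem_triangle hP x).and (.and ?_ ?_)
      · by_cases h : x ∈ P.Ω
        · exact (hP.isOpen_Ω.eventually_mem h).mono fun _ h _ => h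
        · exact Eventually.of_forall fun _ h' => absurd h' h
      · by_cases h : x ∈ frontier P.Ω
        · exact (hzero x h).mono fun _ h _ => h
        · exact Eventually.of_forall fun _ h' => absurd h' h
    -- The local potential at `x` is the increment measured from `x`. What must hold is additivity,
    -- `increment x z = increment x y + increment y z`, for `z` near `y`.
    refine ⟨_, hU, P.increment A x, fun y hy => ?_⟩
    have hyΩ : ∀ᶠ z in 𝓝 y, y ∈ P.Ω → z ∈ P.Ω := by
      by_cases h : y ∈ P.Ω
      · exact (hP.isOpen_Ω.eventually_mem h).mono fun _ h _ => h
      · exact Eventually.of_forall fun _ h' => absurd h' h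
    filter_upwards [nhdsWithin_le_nhds (eventually_mem_triangle hP y), nhdsWithin_le_nhds hyΩ,
      self_mem_nhdsWithin] with z hz hzΩ hzU
    by_cases h : ∃ T ∈ P.elements, z ∈ triangle T
    · obtain ⟨T, hT, hzT⟩ := h
      have hyT := hz T hT hzT
      have hxT := hy.1 T hT hyT
      rw [increment_eq hA hT hxT hzT, increment_eq hA hT hxT hyT, increment_eq hA hT hyT hzT]
      ring
    -- For `z` outside the mesh both increments to `z` are zero. If `y` is in the mesh, then the
    -- presence of `z` nearby puts both `x` and `y` on the boundary, where `hzero` makes the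
    -- increment from `x` to `y` vanish.
    · have hz0 : ∀ T ∈ P.elements, z ∉ triangle T := fun T hT h' => h ⟨T, hT, h'⟩
      have hznΩ : z ∉ P.Ω := fun h' =>
        h (exists_mem_triangle hP (interior_subset (hP.mesh_interior ▸ h')))
      rw [increment_eq_zero hz0, increment_eq_zero hz0]
      by_cases hy' : ∃ T ∈ P.elements, y ∈ triangle T
      · obtain ⟨T, hT, hyT⟩ := hy'
        have hyf := (triangle_subset_union hP hT hyT).resolve_left fun h' => hznΩ (hzΩ h')
        have hxf := (triangle_subset_union hP hT (hy.1 T hT hyT)).resolve_left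
          fun h' => hznΩ (hzU.2.1 h')
        rw [hy.2.2 hxf hyf, sub_self]
      · rw [increment_eq_zero fun T hT h' => hy' ⟨T, hT, h'⟩, sub_self]
  obtain ⟨R, hR, hball⟩ : ∃ R : ℝ, 0 < R ∧ P.mesh.space ⊆ planeRect (-R) R (-R) R := by
    obtain ⟨R, hR, h⟩ := hP.isBounded_Ω.closure.exists_pos_norm_le
    refine ⟨R, hR, fun x hx => ?_⟩
    rw [hP.mesh_space] at hx
    have h' : ∀ i, |x i| ≤ R := fun i => by
      simpa using (PiLp.norm_apply_le x i).trans (h x hx)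
    exact ⟨abs_le.1 (h' 0), abs_le.1 (h' 1)⟩
  obtain ⟨u, hu⟩ := exists_hasLocalIncrements_planeRect hloc hR
  replace hu := hu.mono hball
  obtain ⟨x₀, hx₀⟩ := hP.isConnected_boundary.nonempty
  refine ⟨fun x => u x - u x₀, fun T hT a ha b hb => ?_, fun x hx => ?_⟩
  -- On one element `A T` is itself a potential, so it differs from `u` by a constant on that convex
  -- set.
  · have h1 : HasLocalIncrements (P.increment A) (triangle T) (A T) := fun x hx => by
      filter_upwards [self_mem_nhdsWithin] with z hz
      rw [increment_eq hA hT hx hz]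
    have := (hu.mono (triangle_subset_space hT)).sub_eq h1 (convex_triangle T).isPreconnected
      (mem_triangle ha) (mem_triangle hb)
    linarith
  · have hsub : frontier P.Ω ⊆ P.mesh.space := by
      rw [space_eq_union hP]
      exact subset_union_right
    -- On the boundary the zero function is a potential as well. Connectedness of the boundary makes
    -- `u` constant there.
    have h1 : HasLocalIncrements (P.increment A) (frontier P.Ω) 0 := fun x hx => by
      filter_upwards [self_mem_nhdsWithin, nhdsWithin_le_nhds (hzero x hx)] with z hz hz'
      simp [hz' hz]
    simpa using (hu.mono hsub).sub_eq h1 hP.isConnected_boundary.isPreconnected hx₀ hx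

end IFEData

/-! ### The geometry of interface elements -/

theorem Convex.three_mem {S : Set Plane} (hS : Convex ℝ S) {x y z : Plane} (hx : x ∈ S)
    (hy : y ∈ S) (hz : z ∈ S) {a b c : ℝ} (ha : 0 ≤ a) (hb : 0 ≤ b) (hc : 0 ≤ c)
    (h : a + b + c = 1) : a • x + b • y + c • z ∈ S := by
  have := hS.sum_mem (t := Finset.univ) (w := ![a, b, c]) (z := ![x, y, z])
    (by simp [Fin.forall_fin_succ, ha, hb, hc]) (by simpa [Fin.sum_univ_three] using h)
    (by simp [Fin.forall_fin_succ, hx, hy, hz])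
  simpa [Fin.sum_univ_three] using this

theorem Convex.four_mem {S : Set Plane} (hS : Convex ℝ S) {x y z w : Plane} (hx : x ∈ S)
    (hy : y ∈ S) (hz : z ∈ S) (hw : w ∈ S) {a b c d : ℝ} (ha : 0 ≤ a) (hb : 0 ≤ b) (hc : 0 ≤ c)
    (hd : 0 ≤ d) (h : a + b + c + d = 1) : a • x + b • y + c • z + d • w ∈ S := by
  have := hS.sum_mem (t := Finset.univ) (w := ![a, b, c, d]) (z := ![x, y, z, w])
    (by simp [Fin.forall_fin_succ, ha, hb, hc, hd]) (by simpa [Fin.sum_univ_four] using h)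
    (by simp [Fin.forall_fin_succ, hx, hy, hz, hw])
  simpa [Fin.sum_univ_four] using this

namespace IFEData

variable {P : IFEData} {T T' : Finset Plane} {a b x y D E p q r : Plane} {U : Set Plane}

/-- The affine function `x ↦ n · (x - D)`, where `n` is the normal vector to the chord `D E`. -/
def chordForm (D E : Plane) : Plane →ᵃ[ℝ] ℝ :=
  (innerₗ Plane (chordNormal D E)).toAffineMap -
    AffineMap.const ℝ Plane (inner ℝ (chordNormal D E) D)

theorem chordForm_apply (D E x : Plane) :
    chordForm D E x = inner ℝ (chordNormal D E) (x - D) := by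
  simp [chordForm, inner_sub_right]

theorem inner_plane (x y : Plane) : inner ℝ x y = x 0 * y 0 + x 1 * y 1 := by
  simp [PiLp.inner_apply, Fin.sum_univ_two]
  ring

theorem chordForm_left (D E : Plane) : chordForm D E D = 0 := by
  simp [chordForm_apply]

theorem chordForm_right (D E : Plane) : chordForm D E E = 0 := by
  rw [chordForm_apply, inner_plane, chordNormal]
  simp
  ring

theorem isClosed_Γ (hP : P.IsAdmissible) : IsClosed P.Γ := by
  obtain ⟨γ, h1, h2, -, -, h5⟩ := hP.jordan_Γ
  rw [← h5]
  exact (h2.compact_of_continuous one_ne_zero h1.continuous).isClosed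

theorem Γ_disjoint_frontier (hP : P.IsAdmissible) : Disjoint (frontier P.Ω) P.Γ :=
  ((disjoint_frontier hP).mono_left hP.Γ_subset).symm

/-- All the points of a segment in `T` that does not meet the interface lie on the same side. -/
theorem same_side (hP : P.IsAdmissible) (hT : T ∈ P.elements) (hq : q ∈ triangle T)
    (hr : r ∈ triangle T) (h : Disjoint (segment ℝ q r) P.Γ) :
    (∀ x ∈ segment ℝ q r, x ∈ closure (triangle T ∩ P.Ωm) ∧ x ∉ closure (triangle T ∩ P.Ωp)) ∨
    (∀ x ∈ segment ℝ q r, x ∉ closure (triangle T ∩ P.Ωm) ∧ x ∈ closure (triangle T ∩ P.Ωp)) := by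
  have hcomp : IsCompact (segment ℝ q r) := by
    rw [← convexHull_pair]
    exact (Set.toFinite _).isCompact_convexHull ℝ
  obtain ⟨ε, hε, hdisj⟩ := h.exists_thickenings hcomp (isClosed_Γ hP)
  replace hdisj := hdisj.mono_right (Metric.self_subset_thickening hε _)
  -- A thickened segment is convex, so its intersection with the interior of the element is
  -- connected. It avoids `Γ`, hence lies entirely in one subdomain.
  set N := Metric.thickening ε (segment ℝ q r) with hN
  have hNopen : IsOpen N := Metric.isOpen_thickening
  have hsN : segment ℝ q r ⊆ N := Metric.self_subset_thickening hε _
  have hconv : Convex ℝ (N ∩ interior (triangle T)) :=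
    ((convex_segment q r).thickening ε).inter (convex_triangle T).interior
  have hsub : N ∩ interior (triangle T) ⊆ P.Ωm ∪ P.Ωp := by
    rw [hP.union_Ω]
    exact fun x hx => ⟨interior_triangle_subset hP hT hx.2, fun hxΓ => hdisj.le_bot ⟨hx.1, hxΓ⟩⟩
  have hsT : segment ℝ q r ⊆ triangle T := (convex_triangle T).segment_subset hq hr
  have near : ∀ x ∈ segment ℝ q r, ∀ W : Set Plane, IsOpen W → x ∈ W →
      (W ∩ (N ∩ interior (triangle T))).Nonempty := by
    intro x hx W hW hxW
    have : x ∈ closure (interior (triangle T)) := by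
      rw [closure_interior_triangle hT]
      exact hsT hx
    obtain ⟨z, hz, hz'⟩ := mem_closure_iff.1 this (W ∩ N) (hW.inter hNopen) ⟨hxW, hsN hx⟩
    exact ⟨z, hz.1, hz.2, hz'⟩
  have key : ∀ U V : Set Plane, IsOpen V → Disjoint U V → N ∩ interior (triangle T) ⊆ U →
      ∀ x ∈ segment ℝ q r, x ∈ closure (triangle T ∩ U) ∧ x ∉ closure (triangle T ∩ V) := by
    intro U V hV hUV hNU x hx
    constructor
    · rw [mem_closure_iff]
      intro W hW hxW
      obtain ⟨z, hz, hz'⟩ := near x hx W hW hxW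
      exact ⟨z, hz, interior_subset hz'.2, hNU hz'⟩
    · intro hxV
      obtain ⟨z, hzN, hzT, hzV⟩ := mem_closure_iff.1 hxV N hNopen (hsN hx)
      rw [← closure_interior_triangle hT] at hzT
      obtain ⟨w, hw, hw'⟩ := mem_closure_iff.1 hzT (N ∩ V) (hNopen.inter hV) ⟨hzN, hzV⟩
      exact hUV.le_bot ⟨hNU ⟨hw.1, hw'⟩, hw.2⟩
  rcases hconv.isPreconnected.subset_or_subset hP.isOpen_Ωm hP.isOpen_Ωp hP.disjoint_Ω hsub with
    h' | h'
  · exact Or.inl (key _ _ hP.isOpen_Ωp hP.disjoint_Ω h')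
  · exact Or.inr fun x hx => (key _ _ hP.isOpen_Ωm hP.disjoint_Ω.symm h' x hx).symm

/-- Two different edges of a triangle share a vertex; `p` is that vertex. -/
theorem IsCut.exists_vertices (h : P.IsCut T D E) (hT : T ∈ P.elements) :
    ∃ p q r, p ≠ q ∧ p ≠ r ∧ q ≠ r ∧ T = {p, q, r} ∧ D ∈ segment ℝ p q ∧ E ∈ segment ℝ p r := by
  obtain ⟨-, -, a, ha, b, hb, c, hc, d, hd, hab, hcd, hne, hD, hE⟩ := h
  obtain ⟨e, hae, hbe, rfl⟩ := exists_third_vertex hT ha hb hab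
  simp only [Finset.mem_insert, Finset.mem_singleton] at hc hd
  have hD' := segment_symm ℝ a b ▸ hD
  have hE' := segment_symm ℝ c d ▸ hE
  rcases hc with rfl | rfl | rfl <;> rcases hd with rfl | rfl | rfl
  any_goals exact absurd rfl hcd
  · exact absurd rfl hne
  · exact ⟨_, _, _, hab, hae, hbe, rfl, hD, hE⟩
  · exact absurd (pair_comm _ _) hne
  · exact ⟨_, _, _, hab.symm, hbe, hae, by ext; simp; tauto, hD', hE⟩
  · exact ⟨_, _, _, hab, hae, hbe, rfl, hD, hE'⟩
  · exact ⟨_, _, _, hab.symm, hbe, hae, by ext; simp; tauto, hD', hE'⟩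

theorem IsCut.mem_Γ (h : P.IsCut T D E) : D ∈ P.Γ ∧ E ∈ P.Γ := by
  have h1 : D ∈ P.Γ ∩ frontier (triangle T) := by rw [h.2.1]; simp
  have h2 : E ∈ P.Γ ∩ frontier (triangle T) := by rw [h.2.1]; simp
  exact ⟨h1.1, h2.1⟩

theorem IsCut.mem_triangle (h : P.IsCut T D E) : D ∈ triangle T ∧ E ∈ triangle T := by
  have h1 : D ∈ P.Γ ∩ frontier (triangle T) := by rw [h.2.1]; simp
  have h2 : E ∈ P.Γ ∩ frontier (triangle T) := by rw [h.2.1]; simp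
  exact ⟨(isClosed_triangle T).frontier_subset h1.2, (isClosed_triangle T).frontier_subset h2.2⟩

theorem edge_subset_frontier (hT : T ∈ P.elements) (ha : a ∈ T) (hb : b ∈ T) (hab : a ≠ b) :
    segment ℝ a b ⊆ frontier (triangle T) := by
  intro x hx
  rw [(isClosed_triangle T).frontier_eq]
  refine ⟨segment_subset_triangle ha hb hx, fun hx' => ?_⟩
  obtain ⟨c, hac, hbc, h, htri, α, β, γ, hc⟩ := exists_coords hT ha hb hab
  rw [htri, hc.mem_interior_iff, hc.trd_eq_zero hx] at hx'
  exact lt_irrefl _ hx'.2.2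

theorem IsCut.eq_or_eq (h : P.IsCut T D E) (hT : T ∈ P.elements) (ha : a ∈ T) (hb : b ∈ T)
    (hab : a ≠ b) (hx : x ∈ segment ℝ a b) (hxΓ : x ∈ P.Γ) : x = D ∨ x = E := by
  have : x ∈ P.Γ ∩ frontier (triangle T) := ⟨hxΓ, edge_subset_frontier hT ha hb hab hx⟩
  rw [h.2.1] at this
  simpa using this

theorem convex_subElement : Convex ℝ (subElement T D E U) := convex_convexHull ℝ _

theorem isClosed_subElement : IsClosed (subElement T D E U) :=
  (((Set.toFinite {D, E}).union (T.finite_toSet.subset fun _ h => h.1)).isCompact_convexHull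
    ℝ).isClosed

theorem left_mem_subElement : D ∈ subElement T D E U := subset_convexHull ℝ _ (by simp)

theorem right_mem_subElement : E ∈ subElement T D E U := subset_convexHull ℝ _ (by simp)

theorem vertex_mem_subElement (ha : a ∈ T) (h : a ∈ closure (triangle T ∩ U)) :
    a ∈ subElement T D E U := subset_convexHull ℝ _ (Or.inr ⟨ha, h⟩)

theorem subElement_subset_of {S : Set Plane} (hS : Convex ℝ S) (hD : D ∈ S) (hE : E ∈ S)
    (h : ∀ a ∈ T, a ∈ closure (triangle T ∩ U) → a ≠ D → a ≠ E → a ∈ S) :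
    subElement T D E U ⊆ S := by
  refine convexHull_min ?_ hS
  rintro z ((rfl | rfl) | ⟨h1, h2⟩)
  · exact hD
  · exact hE
  · by_cases hzD : z = D
    · rwa [hzD]
    by_cases hzE : z = E
    · rwa [hzE]
    exact h z h1 h2 hzD hzE

/-- With no vertex on the side of `U` apart from `D` and `E`, that part of the element degenerates
to the chord. -/
theorem chordForm_eq_zero_of_mem
    (h : ∀ a ∈ T, a ≠ D → a ≠ E → a ∉ closure (triangle T ∩ U)) (hx : x ∈ subElement T D E U) :
    chordForm D E x = 0 :=
  subElement_subset_of (S := chordForm D E ⁻¹' {0}) ((convex_singleton _).affine_preimage _)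
    (chordForm_left D E) (chordForm_right D E) (fun a ha h1 h2 h3 => absurd h1 (h a ha h2 h3)) hx

theorem triangle_subset_subElement
    (h : ∀ a ∈ T, a ≠ D → a ≠ E → a ∈ closure (triangle T ∩ U)) :
    triangle T ⊆ subElement T D E U := by
  refine convexHull_min (fun a ha => ?_) convex_subElement
  by_cases h1 : a = D
  · rw [h1]; exact left_mem_subElement
  by_cases h2 : a = E
  · rw [h2]; exact right_mem_subElement
  exact vertex_mem_subElement ha (h a ha h1 h2)

/-- The sets of values of the chord form that occur on one side of a chord. -/
def IsSignSet (J : Set ℝ) : Prop := J = ∅ ∨ J = univ ∨ J = Iic 0 ∨ J = Ici 0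

/-- Off the chord line, the set `S` is cut out of the triangle by the sign of the chord form. -/
def SplitBy (T : Finset Plane) (S : Set Plane) (D E : Plane) (J : Set ℝ) : Prop :=
  IsSignSet J ∧
    ∀ x ∈ triangle T, chordForm D E x ≠ 0 → (x ∈ S ↔ chordForm D E x ∈ J)

/-- The part of the triangle `p q r` near the vertex `p`, respectively away from it, that the
chord from `D ∈ [p, q]` to `E ∈ [p, r]` cuts off. -/
theorem mem_of_chord {S : Set Plane} (hS : Convex ℝ S) {α β γ : Plane →ᵃ[ℝ] ℝ}
    (hc : IsBarycentric p q r α β γ) (hD : D ∈ segment ℝ p q) (hE : E ∈ segment ℝ p r)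
    (hDp : D ≠ p) (hEp : E ≠ p) (hDS : D ∈ S) (hES : E ∈ S)
    (hx : x ∈ convexHull ℝ ({p, q, r} : Set Plane)) :
    ∃ k : ℝ, chordForm D E x = chordForm D E p * k ∧ (0 ≤ k → p ∈ S → x ∈ S) ∧
      (k ≤ 0 → q ∈ S → r ∈ S → x ∈ S) := by
  obtain ⟨s', s, hs', hs, hss, hDe⟩ := hD
  obtain ⟨t', t, ht', ht, htt, hEe⟩ := hE
  obtain rfl : s' = 1 - s := by linarith
  obtain rfl : t' = 1 - t := by linarith
  have hDdef := hDe.symm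
  have hEdef := hEe.symm
  obtain ⟨h1, h2, h3⟩ := (hc.mem_iff x).1 hx
  have hsum := hc.sum_eq x
  have hcomb := hc.comb_eq x
  have hs0 : 0 < s := hs.lt_of_ne' (by rintro rfl; simp [hDdef] at hDp)
  have ht0 : 0 < t := ht.lt_of_ne' (by rintro rfl; simp [hEdef] at hEp)
  have gD := (congrArg (chordForm D E) hDdef).symm.trans (chordForm_left D E)
  have gE := (congrArg (chordForm D E) hEdef).symm.trans (chordForm_right D E)
  rw [Convex.combo_affine_apply hss] at gD
  rw [Convex.combo_affine_apply htt] at gE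
  simp only [smul_eq_mul] at gD gE
  have gx := hc.affine_apply (chordForm D E) x
  -- With `D = (1 - s) p + s q` and `E = (1 - t) p + t r`, this is the affine function equal to `1`
  -- at `p` and `0` at `D` and `E`. When it is nonnegative it is the weight of `p` in the triangle
  -- `p D E`.
  refine ⟨1 - β x / s - γ x / t, ?_, fun hk hp => ?_, fun hk hq hr => ?_⟩
  · rw [gx]
    field_simp
    linear_combination (s * t * chordForm D E p) * hsum + β x * t * gD + γ x * s * gE
  · have : x = (β x / s) • D + (γ x / t) • E + (1 - β x / s - γ x / t) • p := by
      conv_lhs => rw [← hcomb]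
      rw [hDdef, hEdef]
      have e1 : β x / s * s = β x := by field_simp
      have e2 : γ x / t * t = γ x := by field_simp
      match_scalars
      · linear_combination hsum + e1 + e2
      · linear_combination -e1
      · linear_combination -e2
    rw [this]
    exact hS.three_mem hDS hES hp (by positivity) (by positivity) hk (by ring)
  -- Beyond the chord, `x` is written with weights `w * (β / s)`, `w * (γ / t)` on `D`, `E` and `(1
  -- - w) * β`, `(1 - w) * γ` on `q`, `r`. The equation for `w` matches the coefficient of `p`.
  · obtain ⟨w, hw0, hw1, hw⟩ : ∃ w : ℝ, 0 ≤ w ∧ w ≤ 1 ∧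
        w * (β x / s + γ x / t - (β x + γ x)) = α x := by
      have hle : α x ≤ β x / s + γ x / t - (β x + γ x) := by linarith
      rcases h1.eq_or_lt with h0 | h0
      · exact ⟨0, le_rfl, zero_le_one, by rw [← h0]; ring⟩
      · refine ⟨α x / (β x / s + γ x / t - (β x + γ x)), div_nonneg h1 (h1.trans hle),
          div_le_one_of_le₀ hle (h1.trans hle), div_mul_cancel₀ _ (by linarith)⟩
    have e1 : β x / s * s = β x := by field_simp
    have e2 : γ x / t * t = γ x := by field_simp
    have : x = (w * (β x / s)) • D + (w * (γ x / t)) • E + ((1 - w) * β x) • q +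
        ((1 - w) * γ x) • r := by
      conv_lhs => rw [← hcomb]
      rw [hDdef, hEdef]
      match_scalars
      · linear_combination -hw + w * e1 + w * e2
      · linear_combination -w * e1
      · linear_combination -w * e2
    rw [this]
    have h1w : 0 ≤ 1 - w := by linarith
    exact hS.four_mem hDS hES hq hr (by positivity) (by positivity) (by positivity)
      (by positivity) (by linarith)

theorem vertex_side (hP : P.IsAdmissible) (hT : T ∈ P.elements) (hcut : P.IsCut T D E)
    (ha : a ∈ T) (haD : a ≠ D) (haE : a ≠ E) :
    a ∈ closure (triangle T ∩ P.Ωm) ↔ a ∉ closure (triangle T ∩ P.Ωp) := by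
  have hd : Disjoint (segment ℝ a a) P.Γ := by
    rw [segment_same, disjoint_singleton_left]
    intro haΓ
    obtain ⟨b, hb, hba⟩ := Finset.exists_mem_ne (by rw [hT.2]; norm_num : 1 < T.card) a
    rcases hcut.eq_or_eq hT ha hb hba.symm (left_mem_segment ℝ a b) haΓ with h | h
    · exact haD h
    · exact haE h
  rcases same_side hP hT (mem_triangle ha) (mem_triangle ha) hd with h | h
  all_goals
    have := h a (left_mem_segment ℝ a a)
    tauto

theorem vertices_same_side (hP : P.IsAdmissible) (hT : T ∈ P.elements) (hcut : P.IsCut T D E)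
    (ha : a ∈ T) (hb : b ∈ T) (hab : a ≠ b) (hD : D ∉ segment ℝ a b) (hE : E ∉ segment ℝ a b) :
    a ∈ closure (triangle T ∩ P.Ωm) ↔ b ∈ closure (triangle T ∩ P.Ωm) := by
  have hd : Disjoint (segment ℝ a b) P.Γ := by
    rw [Set.disjoint_left]
    intro x hx hxΓ
    rcases hcut.eq_or_eq hT ha hb hab hx hxΓ with rfl | rfl
    · exact hD hx
    · exact hE hx
  rcases same_side hP hT (mem_triangle ha) (mem_triangle hb) hd with h | h
  all_goals
    have h1 := h a (left_mem_segment ℝ a b)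
    have h2 := h b (right_mem_segment ℝ a b)
    tauto

theorem affine_mul_nonpos (g : Plane →ᵃ[ℝ] ℝ) (hD : D ∈ segment ℝ p q) (hDp : p ≠ D)
    (hg : g D = 0) : g q * g p ≤ 0 := by
  obtain ⟨s', s, hs', hs, hss, rfl⟩ := hD
  have hs0 : 0 < s := hs.lt_of_ne' (by
    rintro rfl
    apply hDp
    rw [show s' = 1 by linarith]
    simp)
  rw [Convex.combo_affine_apply hss, smul_eq_mul, smul_eq_mul] at hg
  by_contra! h
  have h1 : s * (g q * g p) + s' * (g p * g p) = 0 := by linear_combination g p * hg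
  linarith [mul_pos hs0 h, mul_nonneg hs' (mul_self_nonneg (g p))]

theorem convex_affine_nonneg (g : Plane →ᵃ[ℝ] ℝ) (c : ℝ) : Convex ℝ {x | 0 ≤ g x * c} := by
  intro y hy z hz a b ha hb hab
  simp only [mem_ofPred_eq] at hy hz ⊢
  rw [Convex.combo_affine_apply hab, smul_eq_mul, smul_eq_mul]
  have := mul_nonneg ha hy
  have := mul_nonneg hb hz
  linarith

/-! ### Recognizing the two parts of an element by the sign of the chord form. -/

section Chord

variable {α β γ : Plane →ᵃ[ℝ] ℝ}

/-- The part cut off by the chord that contains only the vertex `p`. -/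
theorem mem_subElement_iff_pos (hc : IsBarycentric p q r α β γ) (hTeq : T = {p, q, r})
    (hD : D ∈ segment ℝ p q) (hE : E ∈ segment ℝ p r) (hpD : p ≠ D) (hpE : p ≠ E)
    (hp : p ∈ closure (triangle T ∩ U)) (hq : q ≠ D → q ∉ closure (triangle T ∩ U))
    (hr : r ≠ E → r ∉ closure (triangle T ∩ U)) (hx : x ∈ triangle T)
    (hne : chordForm D E x ≠ 0) :
    x ∈ subElement T D E U ↔ 0 < chordForm D E x * chordForm D E p := by
  have htri : triangle T = convexHull ℝ {p, q, r} := by rw [triangle, hTeq]; simp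
  obtain ⟨k, hk, h1, -⟩ := mem_of_chord convex_subElement hc hD hE hpD.symm hpE.symm
    (left_mem_subElement (T := T) (U := U)) right_mem_subElement (htri ▸ hx)
  constructor
  · intro hxU
    have h0 : 0 ≤ chordForm D E x * chordForm D E p := by
      refine subElement_subset_of (convex_affine_nonneg (chordForm D E) (chordForm D E p))
        (by simp [chordForm_left]) (by simp [chordForm_right]) (fun a ha h1 h2 h3 => ?_) hxU
      rw [hTeq] at ha
      simp only [Finset.mem_insert, Finset.mem_singleton] at ha
      rcases ha with rfl | rfl | rfl
      · exact mul_self_nonneg (chordForm D E a)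
      · exact absurd h1 (hq h2)
      · exact absurd h1 (hr h3)
    refine h0.lt_of_ne' (mul_ne_zero hne fun hp0 => hne ?_)
    rw [hk, hp0, zero_mul]
  · intro h0
    refine h1 ?_ (vertex_mem_subElement (by simp [hTeq]) hp)
    rw [hk] at h0
    by_contra hk0
    nlinarith [mul_self_nonneg (chordForm D E p)]

/-- The part cut off by the chord that contains only the vertices `q` and `r`. -/
theorem mem_subElement_iff_neg (hc : IsBarycentric p q r α β γ) (hTeq : T = {p, q, r})
    (hD : D ∈ segment ℝ p q) (hE : E ∈ segment ℝ p r) (hpD : p ≠ D) (hpE : p ≠ E)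
    (hp : p ∉ closure (triangle T ∩ U)) (hq : q ≠ D → q ∈ closure (triangle T ∩ U))
    (hr : r ≠ E → r ∈ closure (triangle T ∩ U)) (hx : x ∈ triangle T)
    (hne : chordForm D E x ≠ 0) :
    x ∈ subElement T D E U ↔ 0 < chordForm D E x * -(chordForm D E p) := by
  have htri : triangle T = convexHull ℝ {p, q, r} := by rw [triangle, hTeq]; simp
  have hqS : q ∈ subElement T D E U := by
    by_cases h : q = D
    · rw [h]; exact left_mem_subElement
    · exact vertex_mem_subElement (by simp [hTeq]) (hq h)
  have hrS : r ∈ subElement T D E U := by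
    by_cases h : r = E
    · rw [h]; exact right_mem_subElement
    · exact vertex_mem_subElement (by simp [hTeq]) (hr h)
  obtain ⟨k, hk, -, h1⟩ := mem_of_chord convex_subElement hc hD hE hpD.symm hpE.symm
    (left_mem_subElement (T := T) (U := U)) right_mem_subElement (htri ▸ hx)
  constructor
  · intro hxU
    have h0 : 0 ≤ chordForm D E x * -(chordForm D E p) := by
      refine subElement_subset_of (convex_affine_nonneg (chordForm D E) (-(chordForm D E p)))
        (by simp [chordForm_left]) (by simp [chordForm_right]) (fun a ha h1 h2 h3 => ?_) hxU
      rw [hTeq] at ha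
      simp only [Finset.mem_insert, Finset.mem_singleton] at ha
      rcases ha with rfl | rfl | rfl
      · exact absurd h1 hp
      · have := affine_mul_nonpos (chordForm D E) hD hpD (chordForm_left D E)
        simp only [mem_ofPred_eq]
        linarith
      · have := affine_mul_nonpos (chordForm D E) hE hpE (chordForm_right D E)
        simp only [mem_ofPred_eq]
        linarith
    refine h0.lt_of_ne' (mul_ne_zero hne fun hp0 => hne ?_)
    rw [hk, neg_eq_zero.1 hp0, zero_mul]
  · intro h0
    refine h1 ?_ hqS hrS
    rw [hk] at h0
    by_contra! hk0
    nlinarith [mul_self_nonneg (chordForm D E p)]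

end Chord

theorem splitBy_of_pos {S : Set Plane} {c : ℝ}
    (h : ∀ x ∈ triangle T, chordForm D E x ≠ 0 → (x ∈ S ↔ 0 < chordForm D E x * c)) :
    ∃ J, SplitBy T S D E J := by
  rcases lt_trichotomy c 0 with hc | rfl | hc
  · refine ⟨Iic 0, by simp [IsSignSet], fun x hx hne => (h x hx hne).trans ?_⟩
    rw [mem_Iic, hne.le_iff_lt]
    exact ⟨fun h => by by_contra! h'; nlinarith, fun h => mul_pos_of_neg_of_neg h hc⟩
  · exact ⟨∅, by simp [IsSignSet], fun x hx hne => (h x hx hne).trans (by simp)⟩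
  · refine ⟨Ici 0, by simp [IsSignSet], fun x hx hne => (h x hx hne).trans ?_⟩
    rw [mul_pos_iff_of_pos_right hc, mem_Ici, hne.symm.le_iff_lt]

/-- In this lemma and the next, `a`, `b`, `c` stand for the vertices `p`, `q`, `r` lying on the
minus side, and `u`, `v` for `q = D` and `r = E`, in which case the label of that vertex is ignored.
-/
theorem both_or_neither {b c u v : Prop} (h : ¬u → ¬v → (b ↔ c))
    (hall : ¬((¬u → b) ∧ (¬v → c))) (hnone : ¬((¬u → ¬b) ∧ (¬v → ¬c))) : False := by
  tauto

theorem separated_labels {a b c u v : Prop} (h : ¬u → ¬v → (b ↔ c))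
    (hall : ¬(a ∧ (¬u → b) ∧ (¬v → c))) (hnone : ¬(¬a ∧ (¬u → ¬b) ∧ (¬v → ¬c))) :
    (a → (¬u → ¬b) ∧ (¬v → ¬c)) ∧ (¬a → (¬u → b) ∧ (¬v → c)) := by
  tauto

/-- The two parts of an interface element. -/
theorem exists_splitBy (hP : P.IsAdmissible) (hT : T ∈ P.elements) (hcut : P.IsCut T D E) :
    (∃ J, SplitBy T (subElement T D E P.Ωm) D E J) ∧
      ∀ x ∈ subElement T D E P.Ωp, chordForm D E x ≠ 0 → x ∉ subElement T D E P.Ωm := by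
  have side := fun {a} => vertex_side (a := a) hP hT hcut
  by_cases hall : ∀ a ∈ T, a ≠ D → a ≠ E → a ∈ closure (triangle T ∩ P.Ωm)
  · refine ⟨⟨univ, by simp [IsSignSet], fun x hx _ => ?_⟩, fun x hx hne _ => hne ?_⟩
    · simpa using triangle_subset_subElement hall hx
    · exact chordForm_eq_zero_of_mem (fun a ha h1 h2 => (side ha h1 h2).1 (hall a ha h1 h2)) hx
  by_cases hnone : ∀ a ∈ T, a ≠ D → a ≠ E → a ∉ closure (triangle T ∩ P.Ωm)
  · exact ⟨⟨∅, by simp [IsSignSet], fun x _ hne =>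
      ⟨fun h => absurd (chordForm_eq_zero_of_mem hnone h) hne, fun h => h.elim⟩⟩,
      fun x _ hne h => hne (chordForm_eq_zero_of_mem hnone h)⟩
  obtain ⟨p, q, r, hpq, hpr, hqr, hTeq, hD, hE⟩ := hcut.exists_vertices hT
  obtain ⟨α, β, γ, hc⟩ := exists_isBarycentric hT hpq hpr hqr hTeq
  have hpT : p ∈ T := by simp [hTeq]
  have hqT : q ∈ T := by simp [hTeq]
  have hrT : r ∈ T := by simp [hTeq]
  -- The edge opposite to `p` can meet the interface only at its endpoints, so `q` and `r` lie on
  -- the same side unless one of them is an end of the chord.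
  have hDqr : D ∈ segment ℝ q r → D = q := fun h => by
    have h1 := hc.rotate.trd_eq_zero h
    have h2 := hc.trd_eq_zero hD
    have h3 := hc.sum_eq D
    have := hc.comb_eq D
    rw [h1, h2, show β D = 1 by linarith] at this
    simpa using this.symm
  have hEqr : E ∈ segment ℝ q r → E = r := fun h => by
    have h1 := hc.rotate.trd_eq_zero h
    have h2 := hc.rotate.rotate.trd_eq_zero (segment_symm ℝ p r ▸ hE)
    have h3 := hc.sum_eq E
    have := hc.comb_eq E
    rw [h1, h2, show γ E = 1 by linarith] at this
    simpa using this.symm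
  have hqr_side : q ≠ D → r ≠ E →
      (q ∈ closure (triangle T ∩ P.Ωm) ↔ r ∈ closure (triangle T ∩ P.Ωm)) := fun h1 h2 =>
    vertices_same_side hP hT hcut hqT hrT hqr (fun h => h1 (hDqr h).symm)
      (fun h => h2 (hEqr h).symm)
  have hqE : q ≠ E := by
    rintro rfl
    have := hc.rotate.rotate.trd_eq_zero (segment_symm ℝ p r ▸ hE)
    rw [hc.snd_snd] at this
    exact one_ne_zero this
  have hrD : r ≠ D := by
    rintro rfl
    have := hc.trd_eq_zero hD
    rw [hc.trd_trd] at this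
    exact one_ne_zero this
  have hqs := fun h => side hqT h hqE
  have hrs := fun h => side hrT hrD h
  have hps := side hpT
  have hforall : ∀ Q : Plane → Prop, (∀ a ∈ T, Q a) ↔ Q p ∧ Q q ∧ Q r := fun Q => by
    rw [hTeq]; simp
  rw [hforall] at hall hnone
  -- If the chord started at `p`, only `q` and `r` would carry labels, and these could not differ.
  -- The mixed case thus separates `p` from `q` and `r`.
  have hpD : p ≠ D := by
    rintro rfl
    simp only [ne_eq, not_true_eq_false, false_imp_iff, true_and, hqE, hrD, not_false_eq_true,
      true_imp_iff] at hall hnone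
    exact both_or_neither hqr_side hall hnone
  have hpE : p ≠ E := by
    rintro rfl
    simp only [ne_eq, not_true_eq_false, false_imp_iff, imp_true_iff, true_and, hqE, hrD,
      not_false_eq_true, true_imp_iff] at hall hnone
    exact both_or_neither hqr_side hall hnone
  replace hps := hps hpD hpE
  simp only [ne_eq, hpD, hpE, hqE, hrD, not_false_eq_true, true_imp_iff] at hall hnone
  obtain ⟨hon, hoff⟩ := separated_labels hqr_side hall hnone
  have hsubT : subElement T D E P.Ωp ⊆ triangle T := subElement_subset_of (convex_triangle T)
    hcut.mem_triangle.1 hcut.mem_triangle.2 fun a ha _ _ _ => IFEData.mem_triangle ha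
  by_cases hp : p ∈ closure (triangle T ∩ P.Ωm)
  · obtain ⟨hq, hr⟩ := hon hp
    have hm := fun x hx hne => mem_subElement_iff_pos (x := x) hc hTeq hD hE hpD hpE hp hq hr hx hne
    refine ⟨splitBy_of_pos hm, fun x hx hne hx' => ?_⟩
    have h1 := (mem_subElement_iff_neg hc hTeq hD hE hpD hpE (hps.1 hp)
      (fun h => not_not.1 fun h' => hq h ((hqs h).2 h'))
      (fun h => not_not.1 fun h' => hr h ((hrs h).2 h')) (hsubT hx) hne).1 hx
    have h2 := (hm x (hsubT hx) hne).1 hx'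
    linarith
  · obtain ⟨hq, hr⟩ := hoff hp
    have hm := fun x hx hne => mem_subElement_iff_neg (x := x) hc hTeq hD hE hpD hpE hp hq hr hx hne
    refine ⟨splitBy_of_pos hm, fun x hx hne hx' => ?_⟩
    have h1 := (mem_subElement_iff_pos hc hTeq hD hE hpD hpE (not_not.1 fun h' => hp (hps.2 h'))
      (fun h => (hqs h).1 (hq h)) (fun h => (hrs h).1 (hr h)) (hsubT hx) hne).1 hx
    have h2 := (hm x (hsubT hx) hne).1 hx'
    linarith

/-- A boundary edge is not cut by the chord. -/
theorem boundary_edge_subset_or_disjoint (hP : P.IsAdmissible) (hT : T ∈ P.elements)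
    (hcut : P.IsCut T D E) (ha : a ∈ T) (hb : b ∈ T) (hab : a ≠ b)
    (hf : segment ℝ a b ⊆ frontier P.Ω) :
    segment ℝ a b ⊆ subElement T D E P.Ωm ∨ Disjoint (segment ℝ a b) (subElement T D E P.Ωm) := by
  have hd : Disjoint (segment ℝ a b) P.Γ := (Γ_disjoint_frontier hP).mono_left hf
  rcases same_side hP hT (mem_triangle ha) (mem_triangle hb) hd with h | h
  · exact Or.inl (convex_subElement.segment_subset
      (vertex_mem_subElement ha (h a (left_mem_segment ℝ a b)).1)
      (vertex_mem_subElement hb (h b (right_mem_segment ℝ a b)).1))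
  · right
    obtain ⟨c, hac, hbc, hTeq, htri, α, β, γ, hc⟩ := exists_coords hT ha hb hab
    have hpos : ∀ z ∈ triangle T, z ∈ P.Γ → 0 < γ z := fun z hz hzΓ => by
      rw [htri, hc.mem_iff] at hz
      refine hz.2.2.lt_of_ne' fun h0 => ?_
      exact hd.le_bot ⟨hc.mem_segment hz.1 hz.2.1 h0, hzΓ⟩
    -- `D` and `E` lie on `Γ`, hence off the boundary edge, and neither end of the edge is on the
    -- minus side. Every generator of the hull is therefore strictly inside the half plane.
    have hsub : subElement T D E P.Ωm ⊆ γ ⁻¹' Ioi 0 := by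
      refine subElement_subset_of ((convex_Ioi 0).affine_preimage γ)
        (hpos D hcut.mem_triangle.1 hcut.mem_Γ.1) (hpos E hcut.mem_triangle.2 hcut.mem_Γ.2) ?_
      intro z hz hzc _ _
      rw [hTeq] at hz
      simp only [Finset.mem_insert, Finset.mem_singleton] at hz
      rcases hz with rfl | rfl | rfl
      · exact absurd hzc (h _ (left_mem_segment ℝ _ _)).1
      · exact absurd hzc (h _ (right_mem_segment ℝ _ _)).1
      · simp [hc.trd_trd]
    rw [Set.disjoint_left]
    intro z hz hz'
    have := hsub hz'
    rw [mem_preimage, hc.trd_eq_zero hz] at this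
    exact lt_irrefl (0 : ℝ) this

end IFEData

/-! ### Integration by parts for piecewise affine functions -/

section WeakCalculus

variable {φ : Plane → ℝ} {A : Set Plane} {v : Plane}

theorem MeasureTheory.LocallyIntegrable.integrable_mul_test {f : Plane → ℝ} (hf : LocallyIntegrable f)
    (hφ : Continuous φ) (hc : HasCompactSupport φ) : Integrable fun x => f x * φ x := by
  simpa only [smul_eq_mul] using hf.integrable_smul_right_of_hasCompactSupport hφ hc

theorem continuous_fderiv_test (hφ : ContDiff ℝ ∞ φ) (v : Plane) :
    Continuous fun x => fderiv ℝ φ x v :=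
  (hφ.continuous_fderiv (by simp)).clm_apply continuous_const

theorem hasCompactSupport_fderiv_test (hc : HasCompactSupport φ) (v : Plane) :
    HasCompactSupport fun x => fderiv ℝ φ x v := by
  refine hc.mono' fun x hx => ?_
  exact support_fderiv_subset ℝ fun h => hx (by simp [h])

theorem AffineMap.continuous_plane (k : Plane →ᵃ[ℝ] ℝ) : Continuous k :=
  k.continuous_of_finiteDimensional

/-- Integration by parts in a direction in which the set `A` is invariant. -/
theorem integral_indicator_affine_mul_fderiv (hA : MeasurableSet A)
    (hAv : ∀ x (t : ℝ), x + t • v ∈ A ↔ x ∈ A) (k : Plane →ᵃ[ℝ] ℝ) (hφ : ContDiff ℝ ∞ φ)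
    (hc : HasCompactSupport φ) :
    ∫ x, A.indicator k x * fderiv ℝ φ x v =
      -∫ x, A.indicator (fun _ => k.linear v) x * φ x := by
  have hk : LocallyIntegrable (A.indicator k) (volume : Measure Plane) :=
    k.continuous_plane.locallyIntegrable.indicator hA
  have hk' : LocallyIntegrable (A.indicator fun _ => k.linear v) (volume : Measure Plane) :=
    continuous_const.locallyIntegrable.indicator hA
  refine integral_bilinear_hasLineDerivAt_right_eq_neg_left_of_integrable
    (B := ContinuousLinearMap.mul ℝ ℝ) (v := v)
    (hk'.integrable_mul_test hφ.continuous hc)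
    (hk.integrable_mul_test (continuous_fderiv_test hφ v) (hasCompactSupport_fderiv_test hc v))
    (hk.integrable_mul_test hφ.continuous hc) (fun x _ => ?_) (fun x _ => ?_)
  · rw [HasLineDerivAt]
    by_cases hx : x ∈ A
    · have : (fun t : ℝ => A.indicator k (x + t • v)) = fun t => k x + t * k.linear v := by
        ext t
        rw [indicator_of_mem ((hAv x t).2 hx), k.apply_eq_linear_add, k.apply_eq_linear_add x]
        simp
        ring
      rw [this, indicator_of_mem hx]
      simpa using ((hasDerivAt_id (0 : ℝ)).mul_const (k.linear v)).const_add (k x)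
    · have : (fun t : ℝ => A.indicator k (x + t • v)) = fun _ => 0 := by
        ext t
        rw [indicator_of_notMem (fun h => hx ((hAv x t).1 h))]
      rw [this, indicator_of_notMem hx]
      exact hasDerivAt_const _ _
  · exact ((hφ.differentiable (by simp)).differentiableAt (x := x)).hasFDerivAt.hasLineDerivAt v

theorem integral_affine_mul_fderiv (k : Plane →ᵃ[ℝ] ℝ) (v : Plane) (hφ : ContDiff ℝ ∞ φ)
    (hc : HasCompactSupport φ) :
    ∫ x, k x * fderiv ℝ φ x v = -∫ x, k.linear v * φ x := by
  simpa using integral_indicator_affine_mul_fderiv (v := v) MeasurableSet.univ (by simp) k hφ hc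

/-! ### Integration by parts across the chord line. -/

namespace IFEData

variable {D E : Plane} {J : Set ℝ}

/-- The points of the plane on which the chord form takes values outside of `J`. -/
def offSet (D E : Plane) (J : Set ℝ) : Set Plane := {x | chordForm D E x ∉ J}

theorem IsSignSet.measurableSet (hJ : IsSignSet J) : MeasurableSet J := by
  rcases hJ with rfl | rfl | rfl | rfl
  · exact MeasurableSet.empty
  · exact MeasurableSet.univ
  · exact measurableSet_Iic
  · exact measurableSet_Ici

theorem IsSignSet.measurableSet_offSet (hJ : IsSignSet J) (D E : Plane) :
    MeasurableSet (offSet D E J) :=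
  (hJ.measurableSet.preimage (chordForm D E).continuous_plane.measurable).compl

/-- The four truncations are `id`, `0`, `max · 0` and `min · 0`. Cutting off at the zero of the
identity creates no jump. -/
theorem IsSignSet.lipschitz (hJ : IsSignSet J) : LipschitzWith 1 (Jᶜ.indicator (id : ℝ → ℝ)) := by
  rcases hJ with rfl | rfl | rfl | rfl
  · simpa using LipschitzWith.id
  · simpa using (LipschitzWith.const (0 : ℝ)).weaken zero_le_one
  · convert (LipschitzWith.id (α := ℝ)).max_const 0 using 1
    ext m
    rcases le_or_gt m 0 with h | h
    · simp [h]
    · simp [h, h.le]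
  · convert (LipschitzWith.id (α := ℝ)).min_const 0 using 1
    ext m
    rcases le_or_gt 0 m with h | h
    · simp [h]
    · simp [h, h.le]

theorem IsSignSet.eventually (hJ : IsSignSet J) {m : ℝ} (hm : m ≠ 0) :
    ∀ᶠ y in 𝓝 m, (y ∈ J ↔ m ∈ J) := by
  rcases hJ with rfl | rfl | rfl | rfl
  · simp
  · simp
  · rcases hm.lt_or_gt with h | h
    · filter_upwards [gt_mem_nhds h] with y hy
      simp [hy.le, h.le]
    · filter_upwards [lt_mem_nhds h] with y hy
      simp [hy.not_ge, h.not_ge]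
  · rcases hm.lt_or_gt with h | h
    · filter_upwards [gt_mem_nhds h] with y hy
      simp [hy.not_ge, h.not_ge]
    · filter_upwards [lt_mem_nhds h] with y hy
      simp [hy.le, h.le]

theorem chordNormal_ne_zero (h : D ≠ E) : chordNormal D E ≠ 0 := by
  intro h0
  apply h
  have h1 := congrFun (congrArg WithLp.ofLp h0) 0
  have h2 := congrFun (congrArg WithLp.ofLp h0) 1
  simp [chordNormal] at h1 h2
  ext i
  fin_cases i
  · simp; linarith
  · simp; linarith

theorem volume_chord_line (h : D ≠ E) : volume {x | chordForm D E x = 0} = 0 := by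
  have e : {x | chordForm D E x = 0} =
      ((affineSpan ℝ {(0 : ℝ)}).comap (chordForm D E) : Set Plane) := by
    ext x
    simp
  rw [e]
  refine Measure.addHaar_affineSubspace _ _ fun htop => ?_
  have : D + chordNormal D E ∈ (affineSpan ℝ {(0 : ℝ)}).comap (chordForm D E) := by
    rw [htop]; trivial
  have h0 : chordForm D E (D + chordNormal D E) = 0 := by simpa using this
  rw [chordForm_apply, add_sub_cancel_left, inner_self_eq_zero] at h0
  exact chordNormal_ne_zero h h0

theorem ae_chordForm_ne_zero (h : D ≠ E) : ∀ᵐ x : Plane, chordForm D E x ≠ 0 := by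
  rw [ae_iff]
  simpa using volume_chord_line h

theorem lipschitz_chordForm (D E : Plane) : ∃ C, LipschitzWith C (chordForm D E) := by
  refine ⟨‖innerSL ℝ (chordNormal D E)‖₊, ?_⟩
  refine LipschitzWith.of_dist_le_mul fun x y => ?_
  have := (innerSL ℝ (chordNormal D E)).lipschitz.dist_le_mul (x - D) (y - D)
  rw [dist_sub_right] at this
  simpa only [chordForm_apply, innerSL_apply_apply] using this

/-- The truncated chord form is Lipschitz because it vanishes on the line of truncation, so
integration by parts has no boundary term. Off that null line its derivative is the truncated
constant. -/
theorem integral_chordForm_mul_fderiv (h : D ≠ E) (hJ : IsSignSet J) (v : Plane)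
    (hφ : ContDiff ℝ ∞ φ) (hc : HasCompactSupport φ) :
    ∫ x, (offSet D E J).indicator (chordForm D E) x * fderiv ℝ φ x v =
      -∫ x, (offSet D E J).indicator (fun _ => inner ℝ (chordNormal D E) v) x * φ x := by
  obtain ⟨C, hC⟩ := lipschitz_chordForm D E
  obtain ⟨C', hC'⟩ := hφ.lipschitzWith_of_hasCompactSupport hc (by simp)
  have hf : LipschitzWith (1 * C) ((offSet D E J).indicator (chordForm D E)) := hJ.lipschitz.comp hC
  have key := hf.integral_lineDeriv_mul_eq (μ := volume) hC' hc v
  have hl : ∫ x, lineDeriv ℝ ((offSet D E J).indicator (chordForm D E)) x v * φ x =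
      ∫ x, (offSet D E J).indicator (fun _ => inner ℝ (chordNormal D E) v) x * φ x := by
    refine integral_congr_ae ?_
    filter_upwards [ae_chordForm_ne_zero h] with x hx
    congr 1
    have hev : ∀ᶠ y in 𝓝 x, (y ∈ offSet D E J ↔ x ∈ offSet D E J) := by
      filter_upwards [(chordForm D E).continuous_plane.tendsto x |>.eventually
        (hJ.eventually hx)] with y hy
      exact not_congr hy
    have hd : HasLineDerivAt ℝ (chordForm D E) (inner ℝ (chordNormal D E) v) x v := by
      rw [HasLineDerivAt]
      have : (fun t : ℝ => chordForm D E (x + t • v)) =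
          fun t => chordForm D E x + t * inner ℝ (chordNormal D E) v := by
        ext t
        rw [chordForm_apply, chordForm_apply, show x + t • v - D = (x - D) + t • v by abel,
          inner_add_right, inner_smul_right]
      rw [this]
      simpa using ((hasDerivAt_id (0 : ℝ)).mul_const (inner ℝ (chordNormal D E) v)).const_add
        (chordForm D E x)
    by_cases hxA : x ∈ offSet D E J
    · rw [indicator_of_mem hxA, ← hd.lineDeriv]
      refine Filter.EventuallyEq.lineDeriv_eq ?_
      filter_upwards [hev] with y hy
      rw [indicator_of_mem (hy.2 hxA)]
    · rw [indicator_of_notMem hxA]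
      rw [Filter.EventuallyEq.lineDeriv_eq (f := fun _ => (0 : ℝ))]
      · simp [lineDeriv]
      · filter_upwards [hev] with y hy
        rw [indicator_of_notMem fun h => hxA (hy.1 h)]
  rw [← hl, key, ← integral_neg]
  refine integral_congr_ae (Eventually.of_forall fun x => ?_)
  have := ((hφ.differentiable (by simp)).differentiableAt (x := x)).lineDeriv_eq_fderiv (v := -v)
  simp only [this, map_neg]
  ring

/-- The rotated vector `(v₂, -v₁)`. -/
def rot (v : Plane) : Plane := !₂[v 1, -v 0]

theorem rot_fst (v : Plane) : rot v 0 = v 1 := by simp [rot]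

theorem rot_snd (v : Plane) : rot v 1 = -v 0 := by simp [rot]

/-- This rewrites the integrand of the weak curl as a single directional derivative of the test
function. -/
theorem fderiv_rot (φ : Plane → ℝ) (x v : Plane) :
    fderiv ℝ φ x (rot v) = v 1 * partialDeriv 0 φ x - v 0 * partialDeriv 1 φ x := by
  have : rot v = v 1 • EuclideanSpace.single 0 1 - v 0 • EuclideanSpace.single 1 1 := by
    ext i
    fin_cases i <;> simp [rot]
  rw [this, map_sub, map_smul, map_smul]
  rfl

/-- The Nédélec function with coefficients `a` and `b`. -/
def ned (a : Plane) (b : ℝ) (x : Plane) : Plane := a + b • rot x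

theorem continuous_rot : Continuous rot := by
  unfold rot
  fun_prop

theorem continuous_ned (a : Plane) (b : ℝ) : Continuous (ned a b) :=
  continuous_const.add (continuous_rot.const_smul b)

/-- The affine function `x ↦ v · x + c`. -/
def linForm (v : Plane) (c : ℝ) : Plane →ᵃ[ℝ] ℝ :=
  (innerₗ Plane v).toAffineMap + AffineMap.const ℝ Plane c

theorem linForm_apply (v : Plane) (c : ℝ) (x : Plane) : linForm v c x = inner ℝ v x + c := by
  simp [linForm]

theorem linForm_linear (v : Plane) (c : ℝ) (x : Plane) : (linForm v c).linear x = inner ℝ v x := by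
  simp [linForm]

theorem integral_ned_fderiv (a : Plane) (b : ℝ) (hφ : ContDiff ℝ ∞ φ) (hc : HasCompactSupport φ) :
    ∫ x, fderiv ℝ φ x (rot (ned a b x)) = 2 * b * ∫ x, φ x := by
  have e0 : ∀ x : Plane, ned a b x 1 = linForm (EuclideanSpace.single 0 (-b)) (a 1) x := fun x => by
    simp [ned, rot, linForm_apply, inner_plane]
    ring
  have e1 : ∀ x : Plane, ned a b x 0 = linForm (EuclideanSpace.single 1 b) (a 0) x := fun x => by
    simp [ned, rot, linForm_apply, inner_plane]
    ring
  simp only [fderiv_rot, e0, e1]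
  have hint : ∀ (k : Plane →ᵃ[ℝ] ℝ) (i : Fin 2),
      Integrable fun x => k x * partialDeriv i φ x := fun k i =>
    k.continuous_plane.locallyIntegrable.integrable_mul_test (continuous_fderiv_test hφ _)
      (hasCompactSupport_fderiv_test hc _)
  rw [integral_sub (hint _ _) (hint _ _)]
  have i0 := integral_affine_mul_fderiv (linForm (EuclideanSpace.single 0 (-b)) (a 1))
    (EuclideanSpace.single 0 1) hφ hc
  have i1 := integral_affine_mul_fderiv (linForm (EuclideanSpace.single 1 b) (a 0))
    (EuclideanSpace.single 1 1) hφ hc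
  simp only [partialDeriv, i0, i1, linForm_linear, integral_const_mul]
  simp [inner_plane]
  ring

/-- Applied to jumps: tangential continuity leaves only a normal jump `κ • chordNormal D E`. -/
theorem eq_smul_chordNormal (h : D ≠ E) {w : Plane} (hw : inner ℝ w (E - D) = 0) :
    ∃ κ : ℝ, w = κ • chordNormal D E := by
  have hn := chordNormal_ne_zero h
  have hn2 : inner ℝ (chordNormal D E) (chordNormal D E) ≠ (0 : ℝ) := inner_self_ne_zero.2 hn
  refine ⟨inner ℝ w (chordNormal D E) / inner ℝ (chordNormal D E) (chordNormal D E), ?_⟩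
  rw [inner_plane] at hw
  simp only [inner_plane] at hn2 ⊢
  have c0 : chordNormal D E 0 = (E - D) 1 := by simp [chordNormal]
  have c1 : chordNormal D E 1 = -(E - D) 0 := by simp [chordNormal]
  rw [c0, c1] at hn2 ⊢
  ext i
  fin_cases i
  · simp only [Fin.zero_eta, PiLp.smul_apply, smul_eq_mul, c0]
    rw [div_mul_eq_mul_div, eq_div_iff hn2]
    linear_combination (E - D) 0 * hw
  · simp only [Fin.mk_one, PiLp.smul_apply, smul_eq_mul, c1]
    rw [div_mul_eq_mul_div, eq_div_iff hn2]
    linear_combination (E - D) 1 * hw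

/-- A Nédélec function with zero tangential component at one point of the line has it zero on the
whole line. Its rotation splits into a component along the line, where the truncation is invisible,
and a normal component proportional to the chord form, where the truncation is Lipschitz. -/
theorem integral_offSet_ned_fderiv (h : D ≠ E) (hJ : IsSignSet J) {a X : Plane} {b : ℝ}
    (hX : chordForm D E X = 0) (hXt : inner ℝ (ned a b X) (E - D) = 0)
    (hφ : ContDiff ℝ ∞ φ) (hc : HasCompactSupport φ) :
    ∫ x, (offSet D E J).indicator (fun _ => (1 : ℝ)) x * fderiv ℝ φ x (rot (ned a b x)) =
      2 * b * ∫ x, (offSet D E J).indicator (fun _ => (1 : ℝ)) x * φ x := by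
  obtain ⟨κ, hκ⟩ := eq_smul_chordNormal h hXt
  set e := E - D with he
  set n := chordNormal D E with hn
  have n0 : n 0 = e 1 := by simp [hn, chordNormal, he]
  have n1 : n 1 = -e 0 := by simp [hn, chordNormal, he]
  have hee : inner ℝ e e = inner ℝ n n := by
    rw [inner_plane, inner_plane, n0, n1]; ring
  have hee0 : inner ℝ n n ≠ (0 : ℝ) := inner_self_ne_zero.2 (chordNormal_ne_zero h)
  set A := offSet D E J with hA
  have hAm : MeasurableSet A := hJ.measurableSet_offSet D E
  -- This is `e · rot (ned a b x)`; the corresponding normal component is `-b` times the chord form.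
  -- Each contributes `-b * (n · n)` to the divergence, whence the factor `2 * b`.
  set k : Plane →ᵃ[ℝ] ℝ := linForm (-b • e) (b * inner ℝ e X - κ * inner ℝ e e) with hk
  have hdecomp : ∀ x, inner ℝ n n * fderiv ℝ φ x (rot (ned a b x)) =
      k x * fderiv ℝ φ x e - b * (chordForm D E x * fderiv ℝ φ x n) := by
    intro x
    have : inner ℝ n n • rot (ned a b x) = k x • e - (b * chordForm D E x) • n := by
      have hx : chordForm D E x = inner ℝ n (x - X) := by
        rw [← sub_zero (chordForm D E x), ← hX, chordForm_apply, chordForm_apply,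
          ← inner_sub_right, sub_sub_sub_cancel_right]
      have h0 := congrFun (congrArg WithLp.ofLp hκ) 0
      have h1 := congrFun (congrArg WithLp.ofLp hκ) 1
      simp only [ned, PiLp.add_apply, PiLp.smul_apply, smul_eq_mul, rot_fst, rot_snd, n0, n1]
        at h0 h1
      have hnn : inner ℝ n n = e 0 ^ 2 + e 1 ^ 2 := by rw [inner_plane, n0, n1]; ring
      rw [hx, hk, linForm_apply, hee, hnn]
      ext i
      fin_cases i
      · simp [inner_plane, rot, ned, n0, n1]
        linear_combination (e 0 ^ 2 + e 1 ^ 2) * h1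
      · simp [inner_plane, rot, ned, n0, n1]
        linear_combination -(e 0 ^ 2 + e 1 ^ 2) * h0
    have := congrArg (fderiv ℝ φ x) this
    rw [map_smul, map_sub, map_smul, map_smul] at this
    simp only [smul_eq_mul] at this
    linarith
  have hAv : ∀ x (t : ℝ), x + t • e ∈ A ↔ x ∈ A := fun x t => by
    have : chordForm D E (x + t • e) = chordForm D E x := by
      rw [chordForm_apply, chordForm_apply, show x + t • e - D = (x - D) + t • e by abel,
        inner_add_right, inner_smul_right, ← hn]
      have : inner ℝ n e = (0 : ℝ) := by rw [inner_plane, n0, n1]; ring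
      rw [this]; ring
    simp [hA, offSet, this]
  have I1 := integral_indicator_affine_mul_fderiv hAm hAv k hφ hc
  have I2 := integral_chordForm_mul_fderiv h hJ n hφ hc
  rw [← hA, ← hn] at I2
  rw [← mul_right_inj' hee0, ← integral_const_mul]
  have hl : ∀ x, inner ℝ n n * (A.indicator (fun _ => (1 : ℝ)) x *
      fderiv ℝ φ x (rot (ned a b x))) = A.indicator k x * fderiv ℝ φ x e -
        b * (A.indicator (chordForm D E) x * fderiv ℝ φ x n) := fun x => by
    by_cases hx : x ∈ A
    · simp only [indicator_of_mem hx, one_mul]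
      exact hdecomp x
    · simp [indicator_of_notMem hx]
  simp only [hl]
  have loc : ∀ (k : Plane →ᵃ[ℝ] ℝ) (v : Plane),
      Integrable fun x => A.indicator k x * fderiv ℝ φ x v := fun k v =>
    (k.continuous_plane.locallyIntegrable.indicator hAm).integrable_mul_test
      (continuous_fderiv_test hφ v) (hasCompactSupport_fderiv_test hc v)
  have hone : ∀ c : ℝ, ∫ x, A.indicator (fun _ => c) x * φ x =
      c * ∫ x, A.indicator (fun _ => (1 : ℝ)) x * φ x := fun c => by
    rw [← integral_const_mul]
    congr 1
    ext x
    by_cases hx : x ∈ A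
    · simp [indicator_of_mem hx]
    · simp [indicator_of_notMem hx]
  rw [integral_sub (loc _ _) ((loc _ _).const_mul b), integral_const_mul, I1, I2,
    hone (k.linear e), hone (inner ℝ n n),
    hk, linForm_linear, inner_smul_left, hee]
  simp only [conj_trivial]
  ring

end IFEData

end WeakCalculus

namespace IFEData

variable {P : IFEData} {T : Finset Plane} {S : Set Plane} {D E : Plane} {J : Set ℝ}
  {φ : Plane → ℝ}

/-! ### Functions that are piecewise smooth with respect to a chord -/

theorem testFun_eq_zero (hφ : φ ∈ testFun T) {x : Plane} (hx : x ∉ interior (triangle T)) :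
    φ x = 0 :=
  image_eq_zero_of_notMem_tsupport fun h => hx (hφ.2.2 h)

theorem testFun_fderiv_eq_zero (hφ : φ ∈ testFun T) {x : Plane}
    (hx : x ∉ interior (triangle T)) : fderiv ℝ φ x = 0 :=
  image_eq_zero_of_notMem_tsupport fun h => hx (hφ.2.2 (tsupport_fderiv_subset ℝ h))

/-- The set `S` and its complement cut the element `T` along the chord from `D` to `E`, and cut no
boundary edge. -/
structure Piece (P : IFEData) (T : Finset Plane) (S : Set Plane) (D E : Plane) (J : Set ℝ) :
    Prop where
  ne : D ≠ E
  measurableSet : MeasurableSet S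
  split : SplitBy T S D E J
  edge : ∀ a ∈ T, ∀ b ∈ T, a ≠ b → segment ℝ a b ⊆ frontier P.Ω →
    segment ℝ a b ⊆ S ∨ Disjoint (segment ℝ a b) S

/-- An uncut element is treated as a cut one with a dummy chord and an empty second part. -/
theorem piece_univ (P : IFEData) (T : Finset Plane) :
    Piece P T univ 0 (EuclideanSpace.single 0 1) univ where
  ne h := by simpa using congrFun (congrArg WithLp.ofLp h) 0
  measurableSet := MeasurableSet.univ
  split := ⟨by simp [IsSignSet], by simp⟩
  edge _ _ _ _ _ _ := Or.inl (subset_univ _)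

theorem exists_piece_of_isCut (hP : P.IsAdmissible) (hT : T ∈ P.elements) (h : P.IsCut T D E) :
    ∃ J, Piece P T (subElement T D E P.Ωm) D E J := by
  obtain ⟨⟨J, hJ⟩, -⟩ := exists_splitBy hP hT h
  exact ⟨J, h.1, isClosed_subElement.measurableSet, hJ,
    fun a ha b hb hab hf => boundary_edge_subset_or_disjoint hP hT h ha hb hab hf⟩

theorem isFiniteMeasure_restrict_triangle (T : Finset Plane) :
    IsFiniteMeasure (volume.restrict (interior (triangle T))) :=
  ⟨by
    rw [Measure.restrict_apply_univ]
    exact (measure_mono interior_subset).trans_lt (isCompact_triangle T).measure_lt_top⟩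

open Classical in
theorem Piece.memLp {F : Type*} [NormedAddCommGroup F] [SecondCountableTopology F]
    (h : Piece P T S D E J) {f g k : Plane → F} (hf : Continuous f) (hg : Continuous g)
    (hk : ∀ x ∈ triangle T, k x = if x ∈ S then f x else g x) :
    MemLp k 2 (volume.restrict (interior (triangle T))) := by
  borelize F
  have hfin := isFiniteMeasure_restrict_triangle T
  obtain ⟨Cf, hCf⟩ := (isCompact_triangle T).exists_bound_of_continuousOn hf.continuousOn
  obtain ⟨Cg, hCg⟩ := (isCompact_triangle T).exists_bound_of_continuousOn hg.continuousOn
  have hmem : MemLp (fun x => if x ∈ S then f x else g x) 2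
      (volume.restrict (interior (triangle T))) := by
    refine MemLp.of_bound (Measurable.ite h.measurableSet hf.measurable
      hg.measurable).aestronglyMeasurable (max Cf Cg) ?_
    filter_upwards [ae_restrict_mem isOpen_interior.measurableSet] with x hx
    split_ifs
    · exact (hCf x (interior_subset hx)).trans (le_max_left _ _)
    · exact (hCg x (interior_subset hx)).trans (le_max_right _ _)
  refine (memLp_congr_ae ?_).1 hmem
  filter_upwards [ae_restrict_mem isOpen_interior.measurableSet] with x hx
  exact (hk x (interior_subset hx)).symm

open Classical in
/-- On the element `T`, the function `F` is continuous, piecewise affine with respect to a chord,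
and `f` is its piecewise gradient. -/
def GradPair (P : IFEData) (T : Finset Plane) (F : Plane → ℝ) (f : Plane → Plane) : Prop :=
  ∃ (S : Set Plane) (D E : Plane) (J : Set ℝ) (a : Plane) (c κ : ℝ), Piece P T S D E J ∧
    ∀ x ∈ triangle T, F x = linForm a c x + (if x ∈ S then 0 else κ * chordForm D E x) ∧
      f x = a + (if x ∈ S then 0 else κ • chordNormal D E)

theorem Piece.mem_offSet_iff (h : Piece P T S D E J) {x : Plane} (hx : x ∈ triangle T)
    (hne : chordForm D E x ≠ 0) : x ∈ offSet D E J ↔ x ∉ S :=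
  not_congr (h.split.2 x hx hne).symm

open Classical in
-- `S` and `offSet` may disagree on the chord line, but the chord form is zero there.
theorem Piece.ite_chordForm (h : Piece P T S D E J) {x : Plane} (hx : x ∈ triangle T) :
    (if x ∈ S then 0 else chordForm D E x) = (offSet D E J).indicator (chordForm D E) x := by
  by_cases hne : chordForm D E x = 0
  · simp [indicator_apply, hne]
  · by_cases hxS : x ∈ S
    · rw [if_pos hxS, indicator_of_notMem fun h' => (h.mem_offSet_iff hx hne).1 h' hxS]
    · rw [if_neg hxS, indicator_of_mem ((h.mem_offSet_iff hx hne).2 hxS)]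

theorem GradPair.memLp {F : Plane → ℝ} {f : Plane → Plane} (h : GradPair P T F f) :
    MemLp F 2 (volume.restrict (interior (triangle T))) ∧
      MemLp f 2 (volume.restrict (interior (triangle T))) := by
  classical
  obtain ⟨S, D, E, J, a, c, κ, hp, h⟩ := h
  refine ⟨hp.memLp (f := linForm a c) (g := fun x => linForm a c x + κ * chordForm D E x)
    (linForm a c).continuous_plane ((linForm a c).continuous_plane.add
      (continuous_const.mul (chordForm D E).continuous_plane)) fun x hx => ?_,
    hp.memLp (f := fun _ => a) (g := fun _ => a + κ • chordNormal D E) continuous_const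
      continuous_const fun x hx => ?_⟩
  · rw [(h x hx).1]
    split_ifs <;> simp
  · rw [(h x hx).2]
    split_ifs <;> simp

/-- The fundamental theorem of calculus along a segment in the element. -/
theorem GradPair.edgeIntegral_eq {F : Plane → ℝ} {f : Plane → Plane} (h : GradPair P T F f)
    {p q : Plane} (hp : p ∈ triangle T) (hq : q ∈ triangle T) :
    edgeIntegral f p q = F q - F p := by
  classical
  obtain ⟨S, D, E, J, a, c, κ, hpc, h⟩ := h
  have hmem : ∀ r ∈ Icc (0 : ℝ) 1, (AffineMap.lineMap p q r : Plane) ∈ triangle T := fun r hr =>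
    (convex_triangle T).segment_subset hp hq (by
      rw [segment_eq_image_lineMap]; exact mem_image_of_mem _ hr)
  have hline : Continuous fun r : ℝ => (AffineMap.lineMap p q r : Plane) := by fun_prop
  set ℓ := chordForm D E with hℓ
  set d := inner ℝ (chordNormal D E) (q - p) with hd
  have hℓr : ∀ r : ℝ, ℓ (AffineMap.lineMap p q r) = ℓ p + r * d := fun r => by
    rw [hℓ, chordForm_apply, chordForm_apply, hd, AffineMap.lineMap_apply_module', ← inner_smul_right,
      ← inner_add_right]
    congr 1
    abel
  have hlr : ∀ r : ℝ, linForm a c (AffineMap.lineMap p q r) =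
      linForm a c p + r * inner ℝ a (q - p) := fun r => by
    rw [linForm_apply, linForm_apply, AffineMap.lineMap_apply_module', inner_add_right,
      inner_smul_right]
    ring
  -- the value of `F` on the element as a continuous function
  have hF : ∀ x ∈ triangle T, F x = linForm a c x + κ * Jᶜ.indicator id (ℓ x) := fun x hx => by
    have := hpc.ite_chordForm hx
    rw [(h x hx).1, show Jᶜ.indicator id (ℓ x) = (offSet D E J).indicator ℓ x from rfl, hℓ, ← this]
    split_ifs <;> simp
  set G : ℝ → ℝ := fun r => linForm a c (AffineMap.lineMap p q r) +
    κ * Jᶜ.indicator id (ℓ (AffineMap.lineMap p q r)) with hG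
  set g : ℝ → ℝ := fun r => inner ℝ a (q - p) +
    (if (AffineMap.lineMap p q r : Plane) ∈ S then 0 else κ * d) with hg
  have hGcont : Continuous G := by
    refine ((linForm a c).continuous_plane.comp hline).add (continuous_const.mul ?_)
    exact hpc.split.1.lipschitz.continuous.comp (ℓ.continuous_plane.comp hline)
  have hgmeas : Measurable g := by
    refine measurable_const.add (Measurable.ite ?_ measurable_const measurable_const)
    exact hpc.measurableSet.preimage hline.measurable
  have hgint : IntervalIntegrable g volume 0 1 := by
    rw [intervalIntegrable_iff]
    refine Measure.integrableOn_of_bounded (M := |inner ℝ a (q - p)| + |κ * d|) (by simp)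
      hgmeas.aestronglyMeasurable (Eventually.of_forall fun r => ?_)
    rw [hg, Real.norm_eq_abs]
    refine (abs_add_le _ _).trans (add_le_add le_rfl ?_)
    split_ifs
    · simp [mul_nonneg]
    · exact le_rfl
  have hint : edgeIntegral f p q = ∫ r in (0 : ℝ)..1, g r := by
    refine intervalIntegral.integral_congr fun r hr => ?_
    rw [uIcc_of_le zero_le_one] at hr
    simp only [(h _ (hmem r hr)).2, inner_add_left, hg]
    split_ifs
    · simp
    · rw [inner_smul_left]
      simp [hd]
  have hderiv : ∀ r, HasDerivAt (fun r : ℝ => ℓ p + r * d) d r := fun r => by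
    simpa using ((hasDerivAt_id r).mul_const d).const_add (ℓ p)
  have hderiv' : ∀ r, HasDerivAt (fun r : ℝ => linForm a c p + r * inner ℝ a (q - p))
      (inner ℝ a (q - p)) r := fun r => by
    simpa using ((hasDerivAt_id r).mul_const (inner ℝ a (q - p))).const_add (linForm a c p)
  -- A segment that is not parallel to the chord meets the chord line for at most one parameter, and
  -- the continuous `G` may fail to be differentiable there. A parallel segment has `d = 0`, so the
  -- normal jump is invisible to the tangential integral even if the segment lies on the chord.
  have key : ∫ r in (0 : ℝ)..1, g r = G 1 - G 0 := by
    refine integral_eq_of_hasDerivAt_off_countable_of_le G g zero_le_one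
      (s := {r | d ≠ 0 ∧ ℓ p + r * d = 0}) ?_ hGcont.continuousOn ?_ hgint
    · refine Set.Subsingleton.countable ?_
      rintro r ⟨hd0, hr⟩ r' ⟨-, hr'⟩
      exact mul_right_cancel₀ hd0 (by linarith)
    · rintro r ⟨hr, hrs⟩
      simp only [hG, hlr, hℓr]
      by_cases hd0 : d = 0
      · simp only [hg, hd0, mul_zero, add_zero, ite_self]
        exact (hderiv' r).add_const _
      · have hne : ℓ p + r * d ≠ 0 := fun h0 => hrs ⟨hd0, h0⟩
        refine (hderiv' r).add ?_
        have hT := hmem r (Ioo_subset_Icc_self hr)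
        have hev := ((hderiv r).continuousAt.tendsto).eventually (hpc.split.1.eventually hne)
        have hiff := hpc.split.2 _ hT (by rw [← hℓ, hℓr]; exact hne)
        rw [← hℓ, hℓr] at hiff
        by_cases hJ : ℓ p + r * d ∈ J
        · rw [if_pos (hiff.2 hJ)]
          refine (hasDerivAt_const r (0 : ℝ)).congr_of_eventuallyEq ?_
          filter_upwards [hev] with s hs
          simp [hs.2 hJ]
        · rw [if_neg fun h' => hJ (hiff.1 h')]
          refine ((hderiv r).const_mul κ).congr_of_eventuallyEq ?_
          filter_upwards [hev] with s hs
          rw [indicator_of_mem (show ℓ p + s * d ∈ Jᶜ from fun h' => hJ (hs.1 h')), id]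
  rw [hint, key, hF q hq, hF p hp, hG]
  simp

/-- Piecewise gradients are weak gradients. -/
theorem GradPair.weakGrad {F : Plane → ℝ} {f : Plane → Plane} (h : GradPair P T F f)
    (hφ : φ ∈ testFun T) (i : Fin 2) :
    ∫ x in interior (triangle T), F x * partialDeriv i φ x =
      -∫ x in interior (triangle T), f x i * φ x := by
  classical
  obtain ⟨S, D, E, J, a, c, κ, hpc, h⟩ := h
  set v : Plane := EuclideanSpace.single i 1 with hv
  set A := offSet D E J with hA
  have hAm : MeasurableSet A := hpc.split.1.measurableSet_offSet D E
  have e1 : ∫ x in interior (triangle T), F x * partialDeriv i φ x =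
      ∫ x, (linForm a c x * fderiv ℝ φ x v +
        κ * (A.indicator (chordForm D E) x * fderiv ℝ φ x v)) := by
    refine (setIntegral_congr_fun isOpen_interior.measurableSet (fun x hx => ?_)).trans
      (setIntegral_eq_integral_of_forall_compl_eq_zero fun x hx => by simp [testFun_fderiv_eq_zero hφ hx])
    have := hpc.ite_chordForm (interior_subset hx)
    simp only [(h x (interior_subset hx)).1, hA, ← this, partialDeriv, ← hv]
    split_ifs <;> ring
  have e2 : ∫ x in interior (triangle T), f x i * φ x =
      ∫ x, (inner ℝ a v * φ x +
        κ * (A.indicator (fun _ => inner ℝ (chordNormal D E) v) x * φ x)) := by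
    refine (setIntegral_congr_ae isOpen_interior.measurableSet ?_).trans
      (setIntegral_eq_integral_of_forall_compl_eq_zero fun x hx => by simp [testFun_eq_zero hφ hx])
    filter_upwards [ae_chordForm_ne_zero hpc.ne] with x hne hx
    have hcoord : ∀ w : Plane, inner ℝ w v = w i := fun w => by
      rw [hv, inner_plane]
      fin_cases i <;> simp
    have hiff := hpc.mem_offSet_iff (interior_subset hx) hne
    rw [(h x (interior_subset hx)).2, hcoord, hcoord]
    by_cases hxS : x ∈ S
    · rw [if_pos hxS, indicator_of_notMem fun h' => hiff.1 h' hxS]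
      simp
    · rw [if_neg hxS, indicator_of_mem (hiff.2 hxS)]
      simp
      ring
  have I1 : Integrable fun x => linForm a c x * fderiv ℝ φ x v :=
    (linForm a c).continuous_plane.locallyIntegrable.integrable_mul_test
      (continuous_fderiv_test hφ.1 v) (hasCompactSupport_fderiv_test hφ.2.1 v)
  have I2 : Integrable fun x => A.indicator (chordForm D E) x * fderiv ℝ φ x v :=
    ((chordForm D E).continuous_plane.locallyIntegrable.indicator hAm).integrable_mul_test
      (continuous_fderiv_test hφ.1 v) (hasCompactSupport_fderiv_test hφ.2.1 v)
  have I3 : Integrable fun x : Plane => inner ℝ a v * φ x :=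
    (continuous_const (y := (inner ℝ a v : ℝ))).locallyIntegrable.integrable_mul_test
      hφ.1.continuous hφ.2.1
  have I4 : Integrable fun x =>
      A.indicator (fun _ => (inner ℝ (chordNormal D E) v : ℝ)) x * φ x :=
    (continuous_const.locallyIntegrable.indicator hAm).integrable_mul_test
      hφ.1.continuous hφ.2.1
  rw [e1, e2, integral_add I1 (I2.const_mul κ), integral_add I3 (I4.const_mul κ),
    integral_affine_mul_fderiv _ v hφ.1 hφ.2.1, integral_const_mul κ, integral_const_mul κ,
    hA, integral_chordForm_mul_fderiv hpc.ne hpc.split.1 v hφ.1 hφ.2.1, linForm_linear]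
  ring

theorem rot_add (v w : Plane) : rot (v + w) = rot v + rot w := by
  ext i
  fin_cases i <;> simp [rot]
  ring

theorem ned_add (a a' : Plane) (b b' : ℝ) (x : Plane) :
    ned (a + a') (b + b') x = ned a b x + ned a' b' x := by
  simp only [ned, add_smul]
  abel

theorem ned_sub (a a' : Plane) (b b' : ℝ) (x : Plane) :
    ned (a - a') (b - b') x = ned a b x - ned a' b' x := by
  rw [eq_sub_iff_add_eq, ← ned_add]
  simp

open Classical in
/-- The weak curl of a piecewise Nédélec function. -/
theorem Piece.weakCurl (h : Piece P T S D E J) {am ap X : Plane} {bm bp : ℝ} {f : Plane → Plane}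
    (hf : ∀ x ∈ triangle T, f x = if x ∈ S then ned am bm x else ned ap bp x)
    (hX : chordForm D E X = 0)
    (hXt : inner ℝ (ned ap bp X) (E - D) = inner ℝ (ned am bm X) (E - D)) (hφ : φ ∈ testFun T) :
    ∫ x in interior (triangle T), (f x 1 * partialDeriv 0 φ x - f x 0 * partialDeriv 1 φ x) =
      -∫ x in interior (triangle T), (-2 * if chordForm D E x ∈ J then bm else bp) * φ x := by
  set A := offSet D E J with hA
  have hAm : MeasurableSet A := h.split.1.measurableSet_offSet D E
  set u : Plane → ℝ := fun x => fderiv ℝ φ x (rot (ned am bm x)) with hu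
  set w : Plane → ℝ := fun x => fderiv ℝ φ x (rot (ned (ap - am) (bp - bm) x)) with hw
  have cont : ∀ a b, Continuous fun x => fderiv ℝ φ x (rot (ned a b x)) := fun a b =>
    (hφ.1.continuous_fderiv (by simp)).clm_apply (continuous_rot.comp (continuous_ned a b))
  have supp : ∀ a b, HasCompactSupport fun x => fderiv ℝ φ x (rot (ned a b x)) := fun a b => by
    refine hφ.2.1.mono' fun x hx => ?_
    exact support_fderiv_subset ℝ fun h => hx (by simp [h])
  -- The field is the minus function on the whole element plus the jump, restricted to `A`; the jump
  -- has zero tangential component at `X`.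
  have e1 : ∫ x in interior (triangle T),
      (f x 1 * partialDeriv 0 φ x - f x 0 * partialDeriv 1 φ x) =
      ∫ x, (u x + A.indicator (fun _ => (1 : ℝ)) x * w x) := by
    refine (setIntegral_congr_ae isOpen_interior.measurableSet ?_).trans
      (setIntegral_eq_integral_of_forall_compl_eq_zero fun x hx => by simp [hu, hw, testFun_fderiv_eq_zero hφ hx])
    filter_upwards [ae_chordForm_ne_zero h.ne] with x hne hx
    have hiff := h.mem_offSet_iff (interior_subset hx) hne
    rw [← fderiv_rot, hf x (interior_subset hx)]
    by_cases hxS : x ∈ S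
    · rw [if_pos hxS, indicator_of_notMem fun h' => hiff.1 h' hxS]
      simp [hu]
    · rw [if_neg hxS, indicator_of_mem (hiff.2 hxS), one_mul, hu, hw]
      simp only
      rw [← map_add, ← rot_add, ← ned_add]
      simp
  have e2 : ∫ x in interior (triangle T), (-2 * if chordForm D E x ∈ J then bm else bp) * φ x =
      ∫ x, (-2 * bm * φ x + -2 * (bp - bm) * (A.indicator (fun _ => (1 : ℝ)) x * φ x)) := by
    refine (setIntegral_congr_fun isOpen_interior.measurableSet (fun x hx => ?_)).trans
      (setIntegral_eq_integral_of_forall_compl_eq_zero fun x hx => by simp [testFun_eq_zero hφ hx])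
    by_cases hxJ : chordForm D E x ∈ J
    · simp only [if_pos hxJ]
      rw [indicator_of_notMem (show x ∉ A from fun h' => h' hxJ)]
      ring
    · simp only [if_neg hxJ]
      rw [indicator_of_mem (show x ∈ A from hxJ)]
      ring
  have I1 : Integrable u := (cont _ _).integrable_of_hasCompactSupport (supp _ _)
  have I2 : Integrable fun x => A.indicator (fun _ => (1 : ℝ)) x * w x :=
    (continuous_const.locallyIntegrable.indicator hAm).integrable_mul_test (cont _ _) (supp _ _)
  have I3 : Integrable φ := hφ.1.continuous.integrable_of_hasCompactSupport hφ.2.1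
  have I4 : Integrable fun x => A.indicator (fun _ => (1 : ℝ)) x * φ x :=
    (continuous_const.locallyIntegrable.indicator hAm).integrable_mul_test hφ.1.continuous hφ.2.1
  rw [e1, e2, integral_add I1 I2, integral_add (I3.const_mul _) (I4.const_mul _), hu, hw,
    integral_ned_fderiv am bm hφ.1 hφ.2.1, hA,
    integral_offSet_ned_fderiv h.ne h.split.1 hX (by rw [ned_sub, inner_sub_left, hXt, sub_self])
      hφ.1 hφ.2.1, integral_const_mul, integral_const_mul]
  ring

/-- Piecewise gradients have zero weak curl. -/
theorem GradPair.weakCurl_eq_zero {F : Plane → ℝ} {f : Plane → Plane} (h : GradPair P T F f)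
    (hφ : φ ∈ testFun T) :
    ∫ x in interior (triangle T), (f x 1 * partialDeriv 0 φ x - f x 0 * partialDeriv 1 φ x) = 0 := by
  classical
  obtain ⟨S, D, E, J, a, c, κ, hpc, h⟩ := h
  have hn : inner ℝ (chordNormal D E) (E - D) = 0 := by
    rw [← chordForm_apply, chordForm_right]
  -- Any point of the chord line may serve as `X`, since the jump is a constant normal vector.
  have := hpc.weakCurl (f := f) (am := a) (ap := a + κ • chordNormal D E) (bm := 0) (bp := 0)
    (X := D) (fun x hx => by
      rw [(h x hx).2]
      split_ifs <;> simp [ned]) (chordForm_left D E)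
    (by simp [ned, inner_add_left, inner_smul_left, hn]) hφ
  simpa using this

variable {P : IFEData} {T : Finset Plane} {S : Set Plane} {D E : Plane} {J : Set ℝ}

/-! ### The local spaces -/

/-- The rotation `v ↦ (v₂, -v₁)` as a continuous linear map. -/
def rotL : Plane →L[ℝ] Plane :=
  LinearMap.toContinuousLinearMap
    { toFun := rot
      map_add' := rot_add
      map_smul' := fun c v => by
        ext i
        fin_cases i <;> simp [rot] }

theorem curl_ned (a : Plane) (b : ℝ) (x : Plane) : curl (ned a b) x = -2 * b := by
  have h : HasFDerivAt (ned a b) (b • rotL) x := (rotL.hasFDerivAt.const_smul b).const_add a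
  rw [curl, h.fderiv]
  have e : ∀ v, rotL v = rot v := fun v => rfl
  simp [e, rot]
  ring

theorem mem_nedelec_iff {v : Plane → Plane} : v ∈ nedelec ↔ ∃ a b, v = ned a b := by
  constructor
  · rintro ⟨a, b, h⟩
    exact ⟨a, b, funext h⟩
  · rintro ⟨a, b, rfl⟩
    exact ⟨a, b, fun x => rfl⟩

theorem mem_affineFun_iff {p : Plane → ℝ} : p ∈ affineFun ↔ ∃ a c, p = linForm a c := by
  constructor
  · rintro ⟨a, c, h⟩
    exact ⟨a, c, funext fun x => by rw [h, linForm_apply]⟩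
  · rintro ⟨a, c, rfl⟩
    exact ⟨a, c, fun x => linForm_apply a c x⟩

theorem gradient_linForm (a : Plane) (c : ℝ) (x : Plane) : gradient (linForm a c) x = a := by
  refine HasGradientAt.gradient (hasGradientAt_iff_hasFDerivAt.2 ?_)
  have : (linForm a c : Plane → ℝ) = fun x => InnerProductSpace.toDual ℝ Plane a x + c := by
    ext y
    simp [linForm_apply]
  rw [this]
  exact (ContinuousLinearMap.hasFDerivAt _).add_const c

theorem ned_zero (a x : Plane) : ned a 0 x = a := by simp [ned]

theorem chordForm_midpoint (D E : Plane) : chordForm D E (midpoint ℝ D E) = 0 := by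
  rw [AffineMap.map_midpoint, chordForm_left, chordForm_right, midpoint_self]

theorem chordForm_segment {x : Plane} (hx : x ∈ segment ℝ D E) : chordForm D E x = 0 := by
  obtain ⟨s, t, -, -, hst, rfl⟩ := hx
  rw [Convex.combo_affine_apply hst, chordForm_left, chordForm_right]
  simp

theorem linForm_add_smul (a : Plane) (c κ : ℝ) (x : Plane) :
    linForm (a + κ • chordNormal D E) (c - κ * inner ℝ (chordNormal D E) D) x =
      linForm a c x + κ * chordForm D E x := by
  rw [linForm_apply, linForm_apply, chordForm_apply, inner_add_left, inner_smul_left,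
    inner_sub_right]
  simp only [conj_trivial]
  ring

/-- The gradient of a function in the local `H¹` space lies in the local `H(curl)` space. -/
theorem exists_gradPair_of_mem_localS (hP : P.IsAdmissible) (hT : T ∈ P.elements)
    {F : Plane → ℝ} (hF : F ∈ P.localS T) : ∃ f ∈ P.localIND T, GradPair P T F f := by
  classical
  rcases hF with ⟨hi, p, hp, hF⟩ | ⟨hi, D, E, hcut, pm, hpm, pp, hpp, hcont, hflux, hF⟩
  · obtain ⟨a, c, rfl⟩ := mem_affineFun_iff.1 hp
    refine ⟨fun _ => a, Or.inl ⟨hi, ned a 0, mem_nedelec_iff.2 ⟨a, 0, rfl⟩,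
      fun x _ => (ned_zero a x).symm⟩, univ, 0, _, univ, a, c, 0, piece_univ P T, fun x hx => ?_⟩
    simp [hF x hx]
  · obtain ⟨am, cm, rfl⟩ := mem_affineFun_iff.1 hpm
    obtain ⟨ap, cp, rfl⟩ := mem_affineFun_iff.1 hpp
    obtain ⟨J, hJ⟩ := exists_piece_of_isCut hP hT hcut
    have hD := hcont D (left_mem_segment ℝ D E)
    have hE := hcont E (right_mem_segment ℝ D E)
    simp only [linForm_apply] at hD hE
    -- Continuity at both ends of the chord removes the tangential part of the gradient jump; the
    -- value at `D` then fixes `cp`.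
    have hperp : inner ℝ (ap - am) (E - D) = 0 := by
      simp only [inner_sub_left, inner_sub_right]
      linarith
    obtain ⟨κ, hκ⟩ := eq_smul_chordNormal hcut.1 hperp
    have hap : ap = am + κ • chordNormal D E := by rw [← hκ]; abel
    have hcp : cp = cm - κ * inner ℝ (chordNormal D E) D := by
      rw [hap, inner_add_left, inner_smul_left] at hD
      simp only [conj_trivial] at hD
      linarith
    have hmid := hflux (midpoint ℝ D E) (midpoint_mem_segment D E)
    rw [gradient_linForm, gradient_linForm] at hmid
    refine ⟨fun x => if x ∈ subElement T D E P.Ωm then ned am 0 x else ned ap 0 x,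
      Or.inr ⟨hi, D, E, hcut, ned am 0, mem_nedelec_iff.2 ⟨am, 0, rfl⟩, ned ap 0,
        mem_nedelec_iff.2 ⟨ap, 0, rfl⟩, ?_, ?_, ?_, fun x _ => rfl⟩,
      subElement T D E P.Ωm, D, E, J, am, cm, κ, hJ, fun x hx => ⟨?_, ?_⟩⟩
    · rw [ned_zero, ned_zero]
      rw [inner_sub_left] at hperp
      linarith
    · rw [curl_ned, curl_ned]
      ring
    · rw [ned_zero, ned_zero]
      exact hmid.symm
    · rw [hF x hx]
      split_ifs
      · simp
      · rw [hap, hcp, linForm_add_smul]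
    · simp only [ned_zero]
      split_ifs
      · simp
      · exact hap

/-- Properties of the weak curl of a function in the local `H(curl)` space; if it vanishes, then the
function is the gradient of functions in the local `H¹` space. -/
theorem exists_weakCurl_of_mem_localIND (hP : P.IsAdmissible) (hT : T ∈ P.elements)
    {f : Plane → Plane} (hf : f ∈ P.localIND T) :
    ∃ q : Plane → ℝ, MemLp q 2 (volume.restrict (interior (triangle T))) ∧
      (¬ P.IsInterface T → ∃ c : ℝ, ∀ x, q x = c) ∧
      (∀ D E, P.IsInterface T → P.IsCut T D E → ∀ U, U = P.Ωm ∨ U = P.Ωp →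
        ∃ c : ℝ, ∀ᵐ x, x ∈ subElement T D E U → q x = c) ∧
      (∀ φ ∈ testFun T,
        ∫ x in interior (triangle T), (f x 1 * partialDeriv 0 φ x - f x 0 * partialDeriv 1 φ x) =
          -∫ x in interior (triangle T), q x * φ x) ∧
      ((∀ᵐ x, x ∈ interior (triangle T) → q x = 0) →
        ∃ F : Plane → ℝ, ∀ c : ℝ, (fun x => F x + c) ∈ P.localS T ∧
          GradPair P T (fun x => F x + c) f) := by
  classical
  have hpos : volume (interior (triangle T)) ≠ 0 :=
    (isOpen_interior.measure_pos volume (interior_triangle_nonempty hT)).ne'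
  rcases hf with ⟨hi, v, hv, hf⟩ | ⟨hi, D, E, hcut, vm, hvm, vp, hvp, htan, hcurl, hflux, hf⟩
  · obtain ⟨a, b, rfl⟩ := mem_nedelec_iff.1 hv
    have hpc := piece_univ P T
    refine ⟨fun _ => -2 * b, ?_, fun _ => ⟨_, fun _ => rfl⟩, fun D E h => absurd h hi,
      fun φ hφ => ?_, fun hq => ?_⟩
    · exact hpc.memLp (f := fun _ => -2 * b) (g := fun _ => -2 * b) continuous_const
        continuous_const (by simp)
    · have := hpc.weakCurl (f := f) (am := a) (ap := a) (bm := b) (bp := b)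
        (fun x hx => by simp [hf x hx]) (chordForm_left _ _) rfl hφ
      simpa using this
    · have hb : b = 0 := by
        by_contra hb
        refine hpos (measure_mono_null (fun x hx => ?_) (ae_iff.1 hq))
        simp [hx, hb]
      subst hb
      refine ⟨linForm a 0, fun c => ⟨Or.inl ⟨hi, linForm a c, mem_affineFun_iff.2 ⟨a, c, rfl⟩,
        fun x _ => ?_⟩, univ, 0, _, univ, a, c, 0, hpc, fun x hx => ?_⟩⟩
      · simp [linForm_apply]
      · simp [linForm_apply, hf x hx, ned_zero]
  · obtain ⟨am, bm, rfl⟩ := mem_nedelec_iff.1 hvm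
    obtain ⟨ap, bp, rfl⟩ := mem_nedelec_iff.1 hvp
    rw [curl_ned, curl_ned] at hcurl
    obtain ⟨-, hside⟩ := exists_splitBy hP hT hcut
    obtain ⟨J, hpc⟩ := exists_piece_of_isCut hP hT hcut
    have hsubT : ∀ U, subElement T D E U ⊆ triangle T := fun U =>
      subElement_subset_of (convex_triangle T) hcut.mem_triangle.1 hcut.mem_triangle.2
        fun a ha _ _ _ => IFEData.mem_triangle ha
    refine ⟨fun x => -2 * if chordForm D E x ∈ J then bm else bp, ?_, fun h => absurd hi h, ?_,
      fun φ hφ => hpc.weakCurl hf (chordForm_midpoint D E) htan hφ, fun hq => ?_⟩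
    · have hm : MeasurableSet {x | chordForm D E x ∈ J} :=
        hpc.split.1.measurableSet.preimage (chordForm D E).continuous_plane.measurable
      have hq : Measurable fun x => -2 * if chordForm D E x ∈ J then bm else bp :=
        measurable_const.mul (Measurable.ite hm measurable_const measurable_const)
      have hfin := isFiniteMeasure_restrict_triangle T
      refine MemLp.of_bound hq.aestronglyMeasurable (max |-2 * bm| |-2 * bp|)
        (Eventually.of_forall fun x => ?_)
      rw [Real.norm_eq_abs]
      split_ifs
      · exact le_max_left _ _
      · exact le_max_right _ _
    · intro D' E' _ hcut' U hU
      -- The ends of the chord are determined up to order by the element, and the parts do not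
      -- depend on the order.
      have hset : ({D', E'} : Set Plane) = {D, E} := hcut'.2.1.symm.trans hcut.2.1
      have hsub : subElement T D' E' U = subElement T D E U := by
        rw [subElement, subElement, hset]
      rw [hsub]
      rcases hU with rfl | rfl
      · refine ⟨-2 * bm, ?_⟩
        filter_upwards [ae_chordForm_ne_zero hcut.1] with x hne hx
        rw [if_pos ((hpc.split.2 x (hsubT _ hx) hne).1 hx)]
      · refine ⟨-2 * bp, ?_⟩
        filter_upwards [ae_chordForm_ne_zero hcut.1] with x hne hx
        rw [if_neg fun h => hside x hx hne ((hpc.split.2 x (hsubT _ hx) hne).2 h)]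
    · have hμm := hP.μm_pos.ne'
      have hμp := hP.μp_pos.ne'
      have hb : bm = 0 ∧ bp = 0 := by
        -- If both were nonzero, the curl would be nonzero on the whole interior, which has positive
        -- measure. One zero coefficient suffices, as `hcurl` then gives the other; this also covers
        -- a part of measure zero.
        have hor : bm = 0 ∨ bp = 0 := by
          by_contra! hb
          refine hpos (measure_mono_null (fun x hx => ?_) (ae_iff.1 hq))
          simp only [mem_ofPred_eq, Classical.not_imp]
          refine ⟨hx, ?_⟩
          split_ifs
          · simp [hb.1]
          · simp [hb.2]
        rcases hor with rfl | rfl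
        · simpa [hμp] using hcurl
        · simpa [hμm, eq_comm] using hcurl
      obtain ⟨rfl, rfl⟩ := hb
      simp only [ned_zero] at htan hflux hf
      obtain ⟨κ, hκ⟩ := eq_smul_chordNormal hcut.1 (w := ap - am)
        (by rw [inner_sub_left, htan, sub_self])
      have hap : ap = am + κ • chordNormal D E := by rw [← hκ]; abel
      refine ⟨fun x => if x ∈ subElement T D E P.Ωm then linForm am 0 x else
        linForm am 0 x + κ * chordForm D E x, fun c => ⟨Or.inr ⟨hi, D, E, hcut, linForm am c,
          mem_affineFun_iff.2 ⟨_, _, rfl⟩,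
          linForm (am + κ • chordNormal D E) (c - κ * inner ℝ (chordNormal D E) D),
          mem_affineFun_iff.2 ⟨_, _, rfl⟩, fun x hx => ?_, fun x hx => ?_, fun x hx => ?_⟩,
          subElement T D E P.Ωm, D, E, J, am, c, κ, hpc, fun x hx => ⟨?_, ?_⟩⟩⟩
      · rw [linForm_add_smul, chordForm_segment hx]
        ring
      · rw [gradient_linForm, gradient_linForm, ← hap]
        exact hflux.symm
      · simp only [linForm_add_smul]
        simp only [linForm_apply]
        split_ifs <;> ring
      · simp only [linForm_apply]
        split_ifs <;> ring
      · rw [hf x hx]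
        split_ifs
        · simp
        · exact hap

/-- If `F` vanishes on a boundary edge, then the tangential part of its gradient does. -/
theorem GradPair.inner_eq_zero {F : Plane → ℝ} {f : Plane → Plane} (h : GradPair P T F f)
    {a b : Plane} (ha : a ∈ T) (hb : b ∈ T) (hab : a ≠ b)
    (hf : segment ℝ a b ⊆ frontier P.Ω) (hF : ∀ x ∈ segment ℝ a b, F x = 0) {x : Plane}
    (hx : x ∈ segment ℝ a b) : inner ℝ (f x) (b - a) = 0 := by
  classical
  obtain ⟨S, D, E, J, v, c, κ, hpc, h⟩ := h
  have hT := segment_subset_triangle ha hb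
  have hal := left_mem_segment ℝ a b
  have hbl := right_mem_segment ℝ a b
  have Fa := hF a hal
  have Fb := hF b hbl
  rw [(h a (hT hal)).1] at Fa
  rw [(h b (hT hbl)).1] at Fb
  rw [(h x (hT hx)).2]
  rcases hpc.edge a ha b hb hab hf with hS | hS
  · rw [if_pos (hS hal)] at Fa
    rw [if_pos (hS hbl)] at Fb
    rw [if_pos (hS hx)]
    simp only [linForm_apply] at Fa Fb
    rw [add_zero, inner_sub_right]
    linarith
  · rw [if_neg (Set.disjoint_left.1 hS hal)] at Fa
    rw [if_neg (Set.disjoint_left.1 hS hbl)] at Fb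
    rw [if_neg (Set.disjoint_left.1 hS hx)]
    simp only [linForm_apply, chordForm_apply] at Fa Fb
    rw [inner_add_left, inner_smul_left]
    simp only [inner_sub_right, conj_trivial] at Fa Fb ⊢
    linarith

variable {P : IFEData} {T T' : Finset Plane} {φ : Plane → ℝ}

/-! ### The global spaces -/

/-- A common interior point would make the common face two-dimensional, so it would have three
vertices and equal both elements. -/
theorem disjoint_interior_triangle (hT : T ∈ P.elements) (hT' : T' ∈ P.elements) (hne : T ≠ T') :
    Disjoint (interior (triangle T)) (interior (triangle T')) := by
  classical
  rw [disjoint_iff_inter_eq_empty, ← interior_inter, ← not_nonempty_iff_eq_empty]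
  intro h
  have h1 : (interior (convexHull ℝ ((T ∩ T' : Finset Plane) : Set Plane))).Nonempty := by
    rw [Finset.coe_inter]
    exact h.mono (interior_mono (triangle_inter_subset hT hT'))
  have h2 := interior_convexHull_nonempty_iff_affineSpan_eq_top.1 h1
  have hn : (T ∩ T').Nonempty := by
    rw [← Finset.coe_nonempty, ← convexHull_nonempty_iff (𝕜 := ℝ)]
    exact h1.mono interior_subset
  have hf : T ∩ T' ∈ P.mesh.faces := P.mesh.down_closed hT.1 Finset.inter_subset_left hn
  have hr : range ((↑) : (T ∩ T' : Finset Plane) → Plane) = ((T ∩ T' : Finset Plane) : Set Plane) :=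
    Subtype.range_coe
  have h3 := (P.mesh.indep hf).affineSpan_eq_top_iff_card_eq_finrank_add_one.1 (by rw [hr]; exact h2)
  have h4 : (T ∩ T').card = 3 := by simpa using h3
  have e1 : T ∩ T' = T := Finset.eq_of_subset_of_card_le Finset.inter_subset_left
    (by rw [h4, hT.2])
  have e2 : T ∩ T' = T' := Finset.eq_of_subset_of_card_le Finset.inter_subset_right
    (by rw [h4, hT'.2])
  exact hne (e1.symm.trans e2)

theorem ae_interior_of_ae (hP : P.IsAdmissible) (hT : T ∈ P.elements) {p : Plane → Prop}
    (h : ∀ᵐ x ∂volume.restrict P.Ω, p x) :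
    ∀ᵐ x ∂volume.restrict (interior (triangle T)), p x :=
  ae_restrict_of_ae_restrict_of_subset (interior_triangle_subset hP hT) h

/-- Square integrable functions on the elements define a square integrable function on `Ω`. -/
theorem exists_Lp_eq (hP : P.IsAdmissible) {F : Type*} [NormedAddCommGroup F]
    (f : Finset Plane → Plane → F)
    (hf : ∀ T ∈ P.elements, MemLp (f T) 2 (volume.restrict (interior (triangle T)))) :
    ∃ z : Lp F 2 (volume.restrict P.Ω),
      ∀ T ∈ P.elements, z =ᵐ[volume.restrict (interior (triangle T))] f T := by
  classical
  set s := (finite_elements hP).toFinset with hs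
  have hmem : ∀ T, T ∈ s ↔ T ∈ P.elements := by simp [hs]
  have hg : MemLp (fun x => ∑ T ∈ s, (interior (triangle T)).indicator (f T) x) 2
      (volume.restrict P.Ω) := by
    refine memLp_finsetSum s fun T hT => ?_
    rw [hmem] at hT
    rw [memLp_indicator_iff_restrict isOpen_interior.measurableSet,
      Measure.restrict_restrict isOpen_interior.measurableSet,
      inter_eq_left.2 (interior_triangle_subset hP hT)]
    exact hf T hT
  refine ⟨hg.toLp, fun T hT => ?_⟩
  filter_upwards [ae_interior_of_ae hP hT hg.coeFn_toLp,
    ae_restrict_mem isOpen_interior.measurableSet] with x hx hxT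
  rw [hx, Finset.sum_eq_single T, indicator_of_mem hxT]
  · intro T' hT' hne
    exact indicator_of_notMem (fun hxT' => (disjoint_interior_triangle ((hmem _).1 hT') hT
      hne).le_bot ⟨hxT', hxT⟩) _
  · exact fun h => absurd ((hmem T).2 hT) h

/-- The fundamental lemma of the calculus of variations; it turns weak identities into almost
everywhere ones on an element. -/
theorem ae_eq_of_forall_testFun {f g : Plane → ℝ}
    (hf : IntegrableOn f (interior (triangle T))) (hg : IntegrableOn g (interior (triangle T)))
    (h : ∀ φ ∈ testFun T, ∫ x in interior (triangle T), f x * φ x =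
      ∫ x in interior (triangle T), g x * φ x) :
    ∀ᵐ x, x ∈ interior (triangle T) → f x = g x := by
  have key := isOpen_interior.ae_eq_zero_of_integral_contDiff_smul_eq_zero
    (f := fun x => f x - g x) (μ := volume) (hf.sub hg).locallyIntegrableOn fun φ h1 h2 h3 => by
      have hφ : φ ∈ testFun T := ⟨h1, h2, h3⟩
      rw [← setIntegral_eq_integral_of_forall_compl_eq_zero (s := interior (triangle T))
        (fun x hx => by simp [testFun_eq_zero hφ hx])]
      obtain ⟨C, hC⟩ := h2.exists_bound_of_continuous h1.continuous
      have hi : ∀ {k : Plane → ℝ}, IntegrableOn k (interior (triangle T)) →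
          IntegrableOn (fun x => k x * φ x) (interior (triangle T)) := fun hk =>
        hk.mul_bdd h1.continuous.aestronglyMeasurable (Eventually.of_forall hC)
      have e : ∀ x, φ x • (f x - g x) = f x * φ x - g x * φ x := fun x => by
        rw [smul_eq_mul]; ring
      simp only [e]
      rw [integral_sub (hi hf) (hi hg), h φ hφ, sub_self]
  filter_upwards [key] with x hx hxT
  exact sub_eq_zero.1 (hx hxT)

theorem integrableOn_of_memLp {f : Plane → ℝ}
    (hf : MemLp f 2 (volume.restrict (interior (triangle T)))) :
    IntegrableOn f (interior (triangle T)) := by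
  have hfin := isFiniteMeasure_restrict_triangle T
  exact hf.integrable one_le_two

theorem memLp_restrict_interior (hP : P.IsAdmissible) (hT : T ∈ P.elements) {F : Type*}
    [NormedAddCommGroup F] (z : Lp F 2 (volume.restrict P.Ω)) :
    MemLp z 2 (volume.restrict (interior (triangle T))) :=
  (Lp.memLp z).mono_measure (Measure.restrict_mono (interior_triangle_subset hP hT) le_rfl)

theorem memLp_coord {f : Plane → Plane} {μ : Measure Plane} (hf : MemLp f 2 μ) (i : Fin 2) :
    MemLp (fun x => f x i) 2 μ := by
  refine hf.of_le ?_ (Eventually.of_forall fun x => PiLp.norm_apply_le (f x) i)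
  exact (EuclideanSpace.proj i : Plane →L[ℝ] ℝ).continuous.comp_aestronglyMeasurable
    hf.aestronglyMeasurable

theorem isElementwiseGrad_of_gradPair {s : P.ScalarL2} {z : P.VectorL2}
    {F : Finset Plane → Plane → ℝ} {f : Finset Plane → Plane → Plane}
    (hF : ∀ T ∈ P.elements, s =ᵐ[volume.restrict (interior (triangle T))] F T)
    (hf : ∀ T ∈ P.elements, z =ᵐ[volume.restrict (interior (triangle T))] f T)
    (h : ∀ T ∈ P.elements, GradPair P T (F T) (f T)) : P.IsElementwiseGrad s z := by
  intro T hT φ hφ i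
  have e1 : ∫ x in interior (triangle T), s x * partialDeriv i φ x =
      ∫ x in interior (triangle T), F T x * partialDeriv i φ x := by
    refine integral_congr_ae ?_
    filter_upwards [hF T hT] with x hx
    rw [hx]
  have e2 : ∫ x in interior (triangle T), (z x) i * φ x =
      ∫ x in interior (triangle T), (f T x) i * φ x := by
    refine integral_congr_ae ?_
    filter_upwards [hf T hT] with x hx
    rw [hx]
  rw [e1, e2]
  exact (h T hT).weakGrad hφ i

theorem integral_curl_congr {z : P.VectorL2} {f : Plane → Plane}
    (hf : z =ᵐ[volume.restrict (interior (triangle T))] f) :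
    ∫ x in interior (triangle T),
      ((z x) 1 * partialDeriv 0 φ x - (z x) 0 * partialDeriv 1 φ x) =
    ∫ x in interior (triangle T), ((f x) 1 * partialDeriv 0 φ x - (f x) 0 * partialDeriv 1 φ x) := by
  refine integral_congr_ae ?_
  filter_upwards [hf] with x hx
  rw [hx]

theorem integral_zero_mul (hP : P.IsAdmissible) (hT : T ∈ P.elements) :
    ∫ x in interior (triangle T), (0 : P.ScalarL2) x * φ x = 0 := by
  rw [← integral_zero Plane ℝ (μ := volume.restrict (interior (triangle T)))]
  refine integral_congr_ae ?_
  filter_upwards [ae_interior_of_ae hP hT (Lp.coeFn_zero ℝ 2 (volume.restrict P.Ω))] with x hx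
  rw [hx]
  simp

/-- Elementwise gradients of functions in `S0` lie in `IND0`. -/
theorem mem_IND0_of_gradPair {z : P.VectorL2} {F : Finset Plane → Plane → ℝ}
    {f : Finset Plane → Plane → Plane}
    (hnode : ∀ T ∈ P.elements, ∀ T' ∈ P.elements, ∀ A, A ∈ T → A ∈ T' → F T A = F T' A)
    (hbd : ∀ T ∈ P.elements, ∀ x ∈ triangle T, x ∈ frontier P.Ω → F T x = 0)
    (hloc : ∀ T ∈ P.elements, f T ∈ P.localIND T)
    (hf : ∀ T ∈ P.elements, z =ᵐ[volume.restrict (interior (triangle T))] f T)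
    (h : ∀ T ∈ P.elements, GradPair P T (F T) (f T)) : z ∈ P.IND0 := by
  refine ⟨f, fun T hT => ⟨hloc T hT, hf T hT⟩, ?_, ?_⟩
  · intro T hT T' hT' a b ha ha' hb hb' _
    rw [(h T hT).edgeIntegral_eq (mem_triangle ha) (mem_triangle hb),
      (h T' hT').edgeIntegral_eq (mem_triangle ha') (mem_triangle hb'),
      hnode T hT T' hT' a ha ha', hnode T hT T' hT' b hb hb']
  · intro T hT a ha b hb hab hfr x hx
    exact (h T hT).inner_eq_zero ha hb hab hfr
      (fun y hy => hbd T hT y (segment_subset_triangle ha hb hy) (hfr hy)) hx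

/-- Local potentials on interface elements are only piecewise affine. Gluing uses their vertex
values alone, so they may be replaced by affine interpolants. -/
theorem exists_affine_interpolation (hT : T ∈ P.elements) (F : Plane → ℝ) :
    ∃ A : Plane →ᵃ[ℝ] ℝ, ∀ a ∈ T, A a = F a := by
  obtain ⟨a, b, c, -, -, -, h, -, α, β, γ, hc⟩ := exists_coords' hT
  refine ⟨F a • α + F b • β + F c • γ, fun v hv => ?_⟩
  rw [h] at hv
  simp only [Finset.mem_insert, Finset.mem_singleton] at hv
  rcases hv with rfl | rfl | rfl
  · simp [hc.fst_fst, hc.snd_fst, hc.trd_fst]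
  · simp [hc.fst_snd, hc.snd_snd, hc.trd_snd]
  · simp [hc.fst_trd, hc.snd_trd, hc.trd_trd]

theorem vertex_mem_of_mem_triangle {x : Plane} (hT : T ∈ P.elements) (hT' : T' ∈ P.elements)
    (hx : x ∈ T') (hxT : x ∈ triangle T) : x ∈ T := by
  have hf : ({x} : Finset Plane) ∈ P.mesh.faces :=
    P.mesh.down_closed hT'.1 (by simpa using hx) (by simp)
  have := P.mesh.inter_subset_convexHull hf hT.1 ⟨by simp, hxT⟩
  obtain ⟨y, hy, hyT⟩ := convexHull_nonempty_iff.1 ⟨x, this⟩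
  have : y = x := by simpa using hy
  rwa [← this]

theorem edgeIntegral_eq_zero {f : Plane → Plane} {a b x : Plane}
    (h : ∀ y ∈ segment ℝ a b, inner ℝ (f y) (b - a) = 0) (hx : x ∈ segment ℝ a b) :
    edgeIntegral f a x = 0 := by
  have hx' := hx
  rw [segment_eq_image_lineMap] at hx'
  obtain ⟨t, -, ht⟩ := hx'
  have hxa : x - a = t • (b - a) := by
    rw [← ht, AffineMap.lineMap_apply_module']
    simp
  rw [edgeIntegral]
  refine (intervalIntegral.integral_congr (g := fun _ => (0 : ℝ)) fun r hr => ?_).trans (by simp)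
  rw [uIcc_of_le zero_le_one] at hr
  have hmem : (AffineMap.lineMap a x r : Plane) ∈ segment ℝ a b := by
    refine (convex_segment a b).segment_subset (left_mem_segment ℝ a b) hx ?_
    rw [segment_eq_image_lineMap]
    exact mem_image_of_mem _ hr
  simp only [hxa, inner_smul_right, h _ hmem, mul_zero]

/-- A field in `IND0` with zero curl is the elementwise gradient of a function in `S0`. -/
theorem exists_mem_S0_of_curl_eq_zero (hP : P.IsAdmissible) {z : P.VectorL2} (hz : z ∈ P.IND0)
    (hcurl : P.IsElementwiseCurl z 0) : ∃ s ∈ P.S0, P.IsElementwiseGrad s z := by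
  obtain ⟨f, hf, hedge, hbd⟩ := hz
  have hpot : ∀ T ∈ P.elements, ∃ F : Plane → ℝ, ∀ c : ℝ, (fun x => F x + c) ∈ P.localS T ∧
      GradPair P T (fun x => F x + c) (f T) := by
    intro T hT
    obtain ⟨q, hq, -, -, hweak, hF⟩ := exists_weakCurl_of_mem_localIND hP hT (hf T hT).1
    refine hF (ae_eq_of_forall_testFun (integrableOn_of_memLp hq) integrableOn_zero
      fun φ hφ => ?_)
    have h1 := hcurl T hT φ hφ
    rw [integral_curl_congr (hf T hT).2, hweak φ hφ, integral_zero_mul hP hT] at h1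
    simpa using h1
  choose! F hF using hpot
  have hgrad : ∀ T ∈ P.elements, ∀ a ∈ triangle T, ∀ b ∈ triangle T,
      edgeIntegral (f T) a b = F T b - F T a := fun T hT a ha b hb => by
    simpa using (hF T hT 0).2.edgeIntegral_eq ha hb
  -- The increments of `A T` along edges are edge integrals of `f T`, which agree between elements
  -- and vanish on boundary edges.
  choose! A hA using fun T (hT : T ∈ P.elements) => exists_affine_interpolation hT (F T)
  obtain ⟨u, hu, hu0⟩ := exists_potential hP (A := A) (fun T hT T' hT' a b ha ha' hb hb' => by
      rw [hA T hT a ha, hA T hT b hb, hA T' hT' a ha', hA T' hT' b hb']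
      by_cases hab : a = b
      · simp [hab]
      · rw [← hgrad T hT a (mem_triangle ha) b (mem_triangle hb),
          ← hgrad T' hT' a (mem_triangle ha') b (mem_triangle hb')]
        exact hedge T hT T' hT' a b ha ha' hb hb' hab)
    (fun T hT a ha b hb hab hfr => by
      have := hgrad T hT a (mem_triangle ha) b (mem_triangle hb)
      rw [edgeIntegral_eq_zero (hbd T hT a ha b hb hab hfr) (right_mem_segment ℝ a b)] at this
      rw [hA T hT a ha, hA T hT b hb]
      linarith)
  have hvert : ∀ T ∈ P.elements, ∃ c : ℝ, ∀ a ∈ T, F T a + c = u a := fun T hT => by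
    obtain ⟨v, hv⟩ := P.mesh.nonempty_of_mem_faces hT.1
    refine ⟨u v - F T v, fun a ha => ?_⟩
    have := hu T hT v hv a ha
    rw [hA T hT a ha, hA T hT v hv] at this
    linarith
  choose! c hc using hvert
  obtain ⟨s, hs⟩ := exists_Lp_eq hP (fun T x => F T x + c T) fun T hT => (hF T hT (c T)).2.memLp.1
  refine ⟨s, ⟨fun T x => F T x + c T, fun T hT => ⟨(hF T hT (c T)).1, hs T hT⟩, ?_, ?_⟩,
    isElementwiseGrad_of_gradPair hs (fun T hT => (hf T hT).2) fun T hT => (hF T hT (c T)).2⟩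
  · intro T hT T' hT' v hv hv'
    simp only [hc T hT v hv, hc T' hT' v hv']
  · intro T hT x hx hxf
    by_cases hxT : x ∈ T
    · simp only [hc T hT x hxT, hu0 x hxf]
    -- A boundary point that is not a vertex lies inside a boundary edge, which by conformity is an
    -- edge of `T`. Integrating the zero tangential trace from `a` to `x` carries the value zero
    -- from the vertex to `x`.
    obtain ⟨T', hT', a, ha, b, hb, hab, hfr, hxab⟩ := exists_boundary_edge hP hxf
    have hxo : x ∈ openSegment ℝ a b := mem_openSegment_of_ne_left_right
      (by rintro rfl; exact hxT (vertex_mem_of_mem_triangle hT hT' ha hx))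
      (by rintro rfl; exact hxT (vertex_mem_of_mem_triangle hT hT' hb hx)) hxab
    obtain ⟨haT, hbT⟩ := mem_of_mem_openSegment hT' ha hb hab hxo hT hx
    have h1 := hgrad T hT a (mem_triangle haT) x hx
    rw [edgeIntegral_eq_zero (hbd T hT a haT b hbT hab hfr) hxab] at h1
    have h2 := hc T hT a haT
    rw [hu0 a (hfr (left_mem_segment ℝ a b))] at h2
    simp only
    linarith

end IFEData

/-- The gradient maps `S0` into `IND0`, the curl maps `IND0` into `Qh`, and the image of the former
is the kernel of the latter. -/
theorem mainTheorem5 (P : IFEData) (hP : P.IsAdmissible) :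
    (∀ s ∈ P.S0, ∃ z ∈ P.IND0, P.IsElementwiseGrad s z) ∧
    (∀ z ∈ P.IND0, ∃ q ∈ P.Qh, P.IsElementwiseCurl z q) ∧
    {z : P.VectorL2 | ∃ s ∈ P.S0, P.IsElementwiseGrad s z} =
      {z : P.VectorL2 | z ∈ P.IND0 ∧ P.IsElementwiseCurl z 0} := by
  refine ⟨?_, ?_, Subset.antisymm ?_ ?_⟩
  · rintro s ⟨F, hF, hnode, hbd⟩
    choose! f hf1 hf2 using fun T (hT : T ∈ P.elements) =>
      IFEData.exists_gradPair_of_mem_localS hP hT (hF T hT).1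
    obtain ⟨z, hz⟩ := IFEData.exists_Lp_eq hP f fun T hT => (hf2 T hT).memLp.2
    exact ⟨z, IFEData.mem_IND0_of_gradPair hnode hbd hf1 hz hf2,
      IFEData.isElementwiseGrad_of_gradPair (fun T hT => (hF T hT).2) hz hf2⟩
  · rintro z ⟨f, hf, -, -⟩
    choose! q hq1 hq2 hq3 hq4 _ using fun T (hT : T ∈ P.elements) =>
      IFEData.exists_weakCurl_of_mem_localIND hP hT (hf T hT).1
    obtain ⟨Q, hQ⟩ := IFEData.exists_Lp_eq hP q hq1
    refine ⟨Q, fun T hT => ⟨fun hi => ?_, fun D E hi hcut U hU => ?_⟩, fun T hT φ hφ => ?_⟩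
    · obtain ⟨c, hc⟩ := hq2 T hT hi
      refine ⟨c, ?_⟩
      filter_upwards [hQ T hT] with x hx
      rw [hx, hc]
    · obtain ⟨c, hc⟩ := hq3 T hT D E hi hcut U hU
      refine ⟨c, ?_⟩
      have hsub : IFEData.subElement T D E U ⊆ IFEData.triangle T :=
        IFEData.subElement_subset_of (IFEData.convex_triangle T) hcut.mem_triangle.1
          hcut.mem_triangle.2 fun a ha _ _ _ => IFEData.mem_triangle ha
      filter_upwards [ae_restrict_of_ae_restrict_of_subset (interior_mono hsub) (hQ T hT),
        ae_restrict_of_ae hc, ae_restrict_mem isOpen_interior.measurableSet] with x h1 h2 h3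
      rw [h1, h2 (interior_subset h3)]
    · rw [IFEData.integral_curl_congr (hf T hT).2, hq4 T hT φ hφ]
      congr 1
      refine integral_congr_ae ?_
      filter_upwards [hQ T hT] with x hx
      rw [hx]
  · rintro z ⟨s, ⟨F, hF, hnode, hbd⟩, hgrad⟩
    choose! f hf1 hf2 using fun T (hT : T ∈ P.elements) =>
      IFEData.exists_gradPair_of_mem_localS hP hT (hF T hT).1
    -- Weak gradients are unique, so `z` agrees on each element with the piecewise gradient, whose
    -- membership and vanishing curl are known.
    have hz : ∀ T ∈ P.elements,
        z =ᵐ[volume.restrict (interior (IFEData.triangle T))] f T := by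
      intro T hT
      have hcoord : ∀ i : Fin 2, ∀ᵐ x, x ∈ interior (IFEData.triangle T) → z x i = f T x i := by
        intro i
        refine IFEData.ae_eq_of_forall_testFun
          (IFEData.integrableOn_of_memLp
            (IFEData.memLp_coord (IFEData.memLp_restrict_interior hP hT z) i))
          (IFEData.integrableOn_of_memLp (IFEData.memLp_coord (hf2 T hT).memLp.2 i))
          fun φ hφ => ?_
        have h1 := hgrad T hT φ hφ i
        have h2 := (hf2 T hT).weakGrad hφ i
        have h3 : ∫ x in interior (IFEData.triangle T), s x * IFEData.partialDeriv i φ x =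
            ∫ x in interior (IFEData.triangle T), F T x * IFEData.partialDeriv i φ x := by
          refine integral_congr_ae ?_
          filter_upwards [(hF T hT).2] with x hx
          rw [hx]
        linarith
      rw [Filter.EventuallyEq, ae_restrict_iff' isOpen_interior.measurableSet]
      filter_upwards [hcoord 0, hcoord 1] with x h0 h1 hx
      ext i
      fin_cases i
      · exact h0 hx
      · exact h1 hx
    refine ⟨IFEData.mem_IND0_of_gradPair hnode hbd hf1 hz hf2, fun T hT φ hφ => ?_⟩
    rw [IFEData.integral_curl_congr (hz T hT), (hf2 T hT).weakCurl_eq_zero hφ,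
      IFEData.integral_zero_mul hP hT, neg_zero]
  · rintro z ⟨hz, hcurl⟩
    exact IFEData.exists_mem_S0_of_curl_eq_zero hP hz hcurl

end
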